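/- Let $a,q,\sigma_+,\sigma_-\in(0,\infty)$ and $\mu_+>0\ge\mu_-$. Put $$\theta_1^{\pm}=\frac{\sqrt{\mu_\pm^2+2q\sigma_\pm^2}+\mu_\pm}{\sigma_\pm^2},\quad \theta_2^{\pm}=\frac{\sqrt{\mu_\pm^2+2q\sigma_\pm^2}-\mu_\pm}{\sigma_\pm^2},\quad c_-=\frac{\theta_1^--\theta_1^+}{\theta_2^-+\theta_1^-},\quad c_+=\frac{\theta_2^+-\theta_2^-}{\theta_2^++\theta_1^+},$$ $$g^-(x)=e^{-\theta_1^+(x-a)}\mathbf 1_{\{x>a\}}+\big(c_-e^{\theta_2^-(x-a)}+(1-c_-)e^{-\theta_1^-(x-a)}\big)\mathbf 1_{\{x\le a\}},$$ $$g^+(x)=\big((1-c_+)e^{\theta_2^+(x-a)}+c_+e^{-\theta_1^+(x-a)}\big)\mathbf 1_{\{x>a\}}+e^{\theta_2^-(x-a)}\mathbf 1_{\{x\le a\}},$$ and $g(x)=g^+(x)g^-(0)-g^-(x)g^+(0)$ (a $C^1$ function). For $\beta>0$ let $\mathcal D_\zeta=\{(x,y)\in[0,\infty)^2:x+\beta\le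 y\}$, $\zeta(z_1,z_2)=\frac{z_2-z_1-\beta}{g(z_2)-g(z_1)}$ on $\mathcal D_\zeta$, and let $\mathcal M_\zeta$ be the set of global maximizers of $\zeta$ over $\mathcal D_\zeta$. Put $\psi(x,y)=\int_x^y\big(1-\frac{g'(s)}{g'(y)}\big)\,ds$, $\phi_0(x)=\psi(0,x)$ for $x\ge0$, and $$x_0=a+\frac{1}{\theta_2^++\theta_1^+}\ln\frac{(g^+(0)-c_+g^-(0))(\theta_1^+)^2}{(1-c_+)g^-(0)(\theta_2^+)^2},\quad \Theta=c_+(\theta_1^+)^2+(1-c_+)(\theta_2^+)^2,$$ $$a_2=\frac{\ln\frac{\theta_2^++\theta_1^-}{\theta_2^+-\theta_2^-}}{\theta_1^-+\theta_2^-},\quad a_3=\frac{1}{\theta_1^-+\theta_2^-}\ln\frac{(1-c_-c_+)(\theta_1^+)^2-(1-c_+)c_-(\theta_2^+)^2}{(1-c_-)\Theta}$$ (each used only where its logarithm is defined). Case (i) means that one of the following holds: $c_+>0$ and $a\ge a_2$; $c_+>0$ and $0<a_3\le a\le a_2$; $c_+\le0$, $a\ge a_3$ and $\Theta>0$. Case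 (ii) means that one of the following holds: $c_+>0$ and $0<a<a_2\wedge a_3$; $c_+\le0$ and $\Theta\le0$; $c_+\le0$, $0<a<a_3$ and $\Theta>0$. In Case (ii) let $a_7=\sup\{x>x_0:g'(x)\le g'(a)\}$, $(\hat g')_-^{-1}(v)=\inf\{y\in[0,a]:g'(y)\ge v\}$, let $(\hat g')_+^{-1}:[g'(x_0),g'(a_7)]\to[a,x_0]$ be the inverse of $g'|_{[a,x_0]}$, and $$x_3=\inf\Big\{x\in[x_0,a_7]:\int_0^{(\hat g')_+^{-1}(g'(x))}\Big(1-\frac{g'(s)}{g'(x)}\Big)ds\ge0\Big\},\quad x_4=\inf\Big\{x\in[x_0,a_7]:\int_{(\hat g')_-^{-1}(g'(x))}^x\Big(1-\frac{g'(s)}{g'(x)}\Big)ds\ge0\Big\},$$ $\omega_3(x)=\psi(0,x)$ for $x\in[0,(\hat g')_-^{-1}(g'(x_4))]\cup[x_4,\infty)$; $\omega_4(x)=\psi((\hat g')_+^{-1}(g'(x)),x)$ for $x\in[x_0,x_3)$ and $\omega_4(x)=\psi(0,x)$ for $x\in[x_3,\infty)$. Let $\omega_3^{-1}(\beta)$ and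 $\omega_4^{-1}(\beta)$ denote the preimages of $\beta$ in these domains, and put $$B_1=\{\beta>0:g'(\omega_3^{-1}(\beta))<g'(\omega_4^{-1}(\beta))\},\quad B_2=\{\beta>0:g'(\omega_3^{-1}(\beta))>g'(\omega_4^{-1}(\beta))\},\quad B_3=(\omega_4(x_3),\infty),$$ where $g'(\omega_4^{-1}(\beta))$ is read as $+\infty$ if $\beta$ is not a value of $\omega_4$ (so that such $\beta$ belong to $B_1$). Write $\overline B=(0,\infty)\setminus B$. Theorem. - In Case (i), $\phi_0$ is a bijection of $[0,\infty)$ onto itself and, for every $\beta>0$, $\mathcal M_\zeta=\{(0,\phi_0^{-1}(\beta))\}$. - In Case (ii), $g'$ maps $[a,x_0]$ bijectively onto $[g'(x_0),g'(a_7)]$, $\omega_4$ maps $[x_0,\infty)$ bijectively onto $[\omega_4(x_0),\infty)$, and for $\beta>0$ the set $\omega_3^{-1}(\beta)$ is a singleton if $\beta\ne\omega_3(x_4)$, while if $\beta=\omega_3(x_4)$ it equals $\{(\hat g')_-^{-1}(g'(x_4)),x_4\}$ and $g'$ takes the same value at these two points. For every $\beta>0$, with $\hat W=\{(0,y):y\in\omega_3^{-1}(\beta)\}$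 and $\tilde w=\big((\hat g')_+^{-1}(g'(\omega_4^{-1}(\beta))),\omega_4^{-1}(\beta)\big)$, $$\mathcal M_\zeta=\begin{cases}\hat W,&\beta\in B_1\cup B_3,\\ \{\tilde w\},&\beta\in B_2\cap\overline{B_3},\\ \hat W\cup\{\tilde w\},&\beta\in\overline{B_1\cup B_2\cup B_3},\end{cases}$$ where in the last two cases $\beta$ is a value of $\omega_4$, so that $\tilde w$ is defined. Moreover $B_2\cap B_3=\emptyset$. -/

import Mathlib

noncomputable section

namespace ImpulseDividend

open Set MeasureTheory

/-- The parameters of the diffusion `dX = (σ₊ 1_{X>a} + σ₋ 1_{X≤a}) dB + (μ₊ 1_{X>a} + μ₋ 1_{X≤a}) dt`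
together with the discount rate `q`. -/
structure Params where
  a : ℝ
  μp : ℝ
  μm : ℝ
  σp : ℝ
  σm : ℝ
  q : ℝ

namespace Params

variable (P : Params)

/-- `θ₁⁺` -/
def θ1p : ℝ := (√(P.μp ^ 2 + 2 * P.q * P.σp ^ 2) + P.μp) / P.σp ^ 2

/-- `θ₂⁺` -/
def θ2p : ℝ := (√(P.μp ^ 2 + 2 * P.q * P.σp ^ 2) - P.μp) / P.σp ^ 2

/-- `θ₁⁻` -/
def θ1m : ℝ := (√(P.μm ^ 2 + 2 * P.q * P.σm ^ 2) + P.μm) / P.σm ^ 2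

/-- `θ₂⁻` -/
def θ2m : ℝ := (√(P.μm ^ 2 + 2 * P.q * P.σm ^ 2) - P.μm) / P.σm ^ 2

/-- `c₋` -/
def cm : ℝ := (P.θ1m - P.θ1p) / (P.θ2m + P.θ1m)

/-- `c₊` -/
def cp : ℝ := (P.θ2p - P.θ2m) / (P.θ2p + P.θ1p)

/-- `g⁻` -/
def gm (x : ℝ) : ℝ :=
  if P.a < x then Real.exp (-P.θ1p * (x - P.a))
  else P.cm * Real.exp (P.θ2m * (x - P.a)) + (1 - P.cm) * Real.exp (-P.θ1m * (x - P.a))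

/-- `g⁺` -/
def gp (x : ℝ) : ℝ :=
  if P.a < x then
    (1 - P.cp) * Real.exp (P.θ2p * (x - P.a)) + P.cp * Real.exp (-P.θ1p * (x - P.a))
  else Real.exp (P.θ2m * (x - P.a))

/-- `g(x) = g⁺(x) g⁻(0) - g⁻(x) g⁺(0)` -/
def g (x : ℝ) : ℝ := P.gp x * P.gm 0 - P.gm x * P.gp 0

/-- `g'` -/
def g' (x : ℝ) : ℝ := deriv P.g x

/-- The domain `D_ζ`, for the transaction cost `β`. -/
def Dζ (β : ℝ) : Set (ℝ × ℝ) := {z | 0 ≤ z.1 ∧ 0 ≤ z.2 ∧ z.1 + β ≤ z.2}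

/-- `ζ(z₁, z₂)`, for the transaction cost `β`. -/
def ζ (β : ℝ) (z : ℝ × ℝ) : ℝ := (z.2 - z.1 - β) / (P.g z.2 - P.g z.1)

/-- `M_ζ`, the set of global maximizers of `ζ` over `D_ζ`. -/
def Mζ (β : ℝ) : Set (ℝ × ℝ) := {z | z ∈ Dζ β ∧ ∀ w ∈ Dζ β, P.ζ β w ≤ P.ζ β z}

/-- `ψ(x, y) = ∫_x^y (1 - g'(s) / g'(y)) ds` -/
def ψ (x y : ℝ) : ℝ := ∫ s in x..y, (1 - P.g' s / P.g' y)

def x0 : ℝ :=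
  Real.log (((P.gp 0 - P.cp * P.gm 0) * P.θ1p ^ 2) / ((1 - P.cp) * P.gm 0 * P.θ2p ^ 2)) /
    (P.θ2p + P.θ1p) + P.a

def Θ : ℝ := P.cp * P.θ1p ^ 2 + (1 - P.cp) * P.θ2p ^ 2

def a2 : ℝ := Real.log ((P.θ2p + P.θ1m) / (P.θ2p - P.θ2m)) / (P.θ1m + P.θ2m)

def a3 : ℝ :=
  Real.log (((1 - P.cm * P.cp) * P.θ1p ^ 2 - (1 - P.cp) * P.cm * P.θ2p ^ 2) /
    ((1 - P.cm) * P.Θ)) / (P.θ1m + P.θ2m)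

/-- Case (i) for `μ₊ > 0`, `μ₋ ≤ 0`. -/
def CaseI : Prop :=
  (0 < P.cp ∧ P.a2 ≤ P.a) ∨
  (0 < P.cp ∧ 0 < P.a3 ∧ P.a3 ≤ P.a ∧ P.a ≤ P.a2) ∨
  (P.cp ≤ 0 ∧ P.a3 ≤ P.a ∧ 0 < P.Θ)

/-- Case (ii) for `μ₊ > 0`, `μ₋ ≤ 0`. -/
def CaseII : Prop :=
  (0 < P.cp ∧ 0 < P.a ∧ P.a < min P.a2 P.a3) ∨
  (P.cp ≤ 0 ∧ P.Θ ≤ 0) ∨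
  (P.cp ≤ 0 ∧ 0 < P.a ∧ P.a < P.a3 ∧ 0 < P.Θ)

/-- `φ₀(x) = ψ(0, x)`, `x ∈ [0, ∞)`. -/
def φ0 (x : ℝ) : ℝ := P.ψ 0 x

/-- `φ₀⁻¹`, the inverse of `φ₀` on `[0, ∞)`. -/
def φ0Inv (β : ℝ) : ℝ := Function.invFunOn P.φ0 (Ici 0) β

def a7 : ℝ := sSup {x | P.x0 < x ∧ P.g' x ≤ P.g' P.a}

/-- `(ĝ')₋⁻¹`, as a function of the value `v` of the derivative:
`inf {y ∈ [0, a] : g'(y) ≥ v}`. -/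
def gInvMinus (v : ℝ) : ℝ := sInf {y | y ∈ Icc 0 P.a ∧ v ≤ P.g' y}

/-- `(ĝ')₊⁻¹`, the inverse of `g'` restricted to `[a, x₀]`. -/
def gInvPlus (v : ℝ) : ℝ := Function.invFunOn P.g' (Icc P.a P.x0) v

def x3 : ℝ :=
  sInf {x | x ∈ Icc P.x0 P.a7 ∧ 0 ≤ ∫ s in (0 : ℝ)..P.gInvPlus (P.g' x), (1 - P.g' s / P.g' x)}

def x4 : ℝ :=
  sInf {x | x ∈ Icc P.x0 P.a7 ∧ 0 ≤ ∫ s in P.gInvMinus (P.g' x)..x, (1 - P.g' s / P.g' x)}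

/-- The domain of `ω₃`. -/
def ω3Dom : Set ℝ := Icc 0 (P.gInvMinus (P.g' P.x4)) ∪ Ici P.x4

def ω3 (x : ℝ) : ℝ := ∫ s in (0 : ℝ)..x, (1 - P.g' s / P.g' x)

/-- `ω₄`, considered on `[x₀, ∞)`. -/
def ω4 (x : ℝ) : ℝ :=
  if x < P.x3 then ∫ s in P.gInvPlus (P.g' x)..x, (1 - P.g' s / P.g' x)
  else ∫ s in (0 : ℝ)..x, (1 - P.g' s / P.g' x)

/-- `ω₃⁻¹(β)`, as the set of preimages of `β` in the domain of `ω₃`; it is a one-point set except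
for one value of `β`, where it has two points. -/
def ω3Inv (β : ℝ) : Set ℝ := {x | x ∈ P.ω3Dom ∧ P.ω3 x = β}

/-- `ω₄⁻¹`, the inverse of `ω₄` on `[x₀, ∞)`; meaningful for `β ∈ ω₄([x₀, ∞))`. -/
def ω4Inv (β : ℝ) : ℝ := Function.invFunOn P.ω4 (Ici P.x0) β

/-- `B₁ = {β > 0 : g'(ω₃⁻¹(β)) < g'(ω₄⁻¹(β))}`, where `g'(ω₄⁻¹(β))` is read as `+∞` if `β` is not
a value of `ω₄` on `[x₀, ∞)`. -/
def B1 : Set ℝ :=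
  {β | 0 < β ∧ ∃ u ∈ P.ω3Inv β, β ∉ P.ω4 '' Ici P.x0 ∨ P.g' u < P.g' (P.ω4Inv β)}

/-- `B₂ = {β > 0 : g'(ω₃⁻¹(β)) > g'(ω₄⁻¹(β))}`, with the same convention. -/
def B2 : Set ℝ :=
  {β | 0 < β ∧ ∃ u ∈ P.ω3Inv β, β ∈ P.ω4 '' Ici P.x0 ∧ P.g' (P.ω4Inv β) < P.g' u}

def B3 : Set ℝ := Ioi (P.ω4 P.x3)

/-- The pairs `(ŵ₁, ŵ₂) = (0, ω₃⁻¹(β))`: one or two points. -/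
def wHat (β : ℝ) : Set (ℝ × ℝ) := (fun y => ((0 : ℝ), y)) '' P.ω3Inv β

/-- The pair `(w̃₁, w̃₂)`. -/
def wTilde (β : ℝ) : ℝ × ℝ := (P.gInvPlus (P.g' (P.ω4Inv β)), P.ω4Inv β)

end Params

end ImpulseDividend

end

namespace ImpulseDividend

open Set Filter Topology

/-! Maximizing the quotient `ζ` is a fractional programme. For a level v > 0 put T_v(x) = v x - g(x)
(`tilt`). Cross-multiplying, ζ(x, y) ≤ 1/v says T_v(y) - T_v(x) ≤ β v. So if the largest increment
of T_v over 0 ≤ x ≤ y is exactly β v, then max ζ = 1/v and the maximizers of `ζ` are the intervals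
realizing that increment (`Regular.Mζ_eq`). The integrals defining ψ, ω₃, ω₄, x₃, x₄ are increments
of T_v divided by v (`Regular.integral_one_sub`). Since g increases, such a normalized increment
over a fixed interval increases strictly with v (`Regular.tilt_div_lt`). Hence, among competing
families of intervals, the one reaching β v at the smaller level wins.

The two cases of the theorem are two shapes of g', distinguished by the sign of the right second
derivative of g at a. In Case (i), g' increases on [0, ∞), T_v is strictly quasiconcave, the best
start is 0, and the end u is fixed by g'(u) = v and φ₀(u) = β.

In Case (ii), g' increases on [0, a], decreases on [a, x₀] and increases again. Quasiconcavity and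
quasiconvexity on the three pieces leave two families of intervals (`ThreePhase.exists_candidate`):
those from 0 to a point of [0, a] ∪ [x₀, ∞), and those from [a, x₀] to [x₀, ∞). The first reaches β
v at the level of ω₃⁻¹(β); its best end jumps from [0, a] to [x₀, ∞) at the level g'(x₄). The second
is controlled by ω₄, and above the level g'(x₃) it is dominated by starting at 0. Comparing the two
levels gives B₁, B₂ and the tie, while B₃ is the range beyond x₃. -/

/-- Gluing two differentiable functions whose values and derivatives agree at the junction. -/
lemma hasDerivAt_glue {a : ℝ} {f k f' k' : ℝ → ℝ} (hf : ∀ x, HasDerivAt f (f' x) x)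
    (hk : ∀ x, HasDerivAt k (k' x) x) (h0 : f a = k a) (h1 : f' a = k' a) (x : ℝ) :
    HasDerivAt (fun y => if a < y then f y else k y) (if a < x then f' x else k' x) x := by
  rcases lt_trichotomy a x with h | h | h
  · rw [if_pos h]
    refine (hf x).congr_of_eventuallyEq ?_
    filter_upwards [lt_mem_nhds h] with y hy
    rw [if_pos hy]
  · subst h
    rw [if_neg (lt_irrefl _), ← hasDerivWithinAt_univ, ← Iic_union_Ici (a := a)]
    refine HasDerivWithinAt.union ?_ ?_
    · refine (hk a).hasDerivWithinAt.congr (fun y hy => ?_) (by simp)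
      rw [if_neg (not_lt.2 hy)]
    · rw [← h1]
      refine (hf a).hasDerivWithinAt.congr (fun y hy => ?_) (by simp [h0])
      rcases eq_or_lt_of_le (mem_Ici.1 hy) with rfl | h
      · simp [h0]
      · rw [if_pos h]
  · rw [if_neg (not_lt.2 h.le)]
    refine (hk x).congr_of_eventuallyEq ?_
    filter_upwards [gt_mem_nhds h] with y hy
    rw [if_neg (not_lt.2 (le_of_lt hy))]

/-- The derivative of `u ↦ A exp (s (x - a)) + B exp (-t (x - a))`. -/
lemma hasDerivAt_two_exp (A B s t a x : ℝ) :
    HasDerivAt (fun x => A * Real.exp (s * (x - a)) + B * Real.exp (-t * (x - a)))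
      (A * s * Real.exp (s * (x - a)) - B * t * Real.exp (-t * (x - a))) x := by
  have h1 : ∀ c : ℝ, HasDerivAt (fun x => Real.exp (c * (x - a)))
      (Real.exp (c * (x - a)) * (c * 1)) x :=
    fun c => (((hasDerivAt_id x).sub_const a).const_mul c).exp
  exact (((h1 s).const_mul A).add ((h1 (-t)).const_mul B)).congr_deriv (by ring)

/-! ### Signs of the exponents and of the coefficients at 0 -/

namespace Params

variable {P : Params}

/-- The standing assumptions on the parameters. -/
structure Admissible (P : Params) : Prop where
  a_pos : 0 < P.a
  σp_pos : 0 < P.σp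
  σm_pos : 0 < P.σm
  q_pos : 0 < P.q
  μp_pos : 0 < P.μp
  μm_nonpos : P.μm ≤ 0

lemma abs_lt_sqrt_disc {μ q σ : ℝ} (hq : 0 < q) (hσ : 0 < σ) : |μ| < √(μ ^ 2 + 2 * q * σ ^ 2) := by
  rw [← Real.sqrt_sq_eq_abs]
  exact Real.sqrt_lt_sqrt (sq_nonneg _) (by have : 0 < q * σ ^ 2 := by positivity
                                            linarith)

namespace Admissible

lemma θ1p_pos (h : P.Admissible) : 0 < P.θ1p := by
  have := abs_lt.1 (abs_lt_sqrt_disc (μ := P.μp) h.q_pos h.σp_pos)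
  exact div_pos (by linarith) (pow_pos h.σp_pos 2)

lemma θ2p_pos (h : P.Admissible) : 0 < P.θ2p := by
  have := abs_lt.1 (abs_lt_sqrt_disc (μ := P.μp) h.q_pos h.σp_pos)
  exact div_pos (by linarith) (pow_pos h.σp_pos 2)

lemma θ1m_pos (h : P.Admissible) : 0 < P.θ1m := by
  have := abs_lt.1 (abs_lt_sqrt_disc (μ := P.μm) h.q_pos h.σm_pos)
  exact div_pos (by linarith) (pow_pos h.σm_pos 2)

lemma θ2m_pos (h : P.Admissible) : 0 < P.θ2m := by
  have := abs_lt.1 (abs_lt_sqrt_disc (μ := P.μm) h.q_pos h.σm_pos)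
  exact div_pos (by linarith) (pow_pos h.σm_pos 2)

lemma θ2p_lt_θ1p (h : P.Admissible) : P.θ2p < P.θ1p :=
  div_lt_div_of_pos_right (by linarith [h.μp_pos]) (pow_pos h.σp_pos 2)

lemma θ1m_le_θ2m (h : P.Admissible) : P.θ1m ≤ P.θ2m :=
  div_le_div_of_nonneg_right (by linarith [h.μm_nonpos]) (pow_pos h.σm_pos 2).le

lemma cm_mul (h : P.Admissible) : P.cm * (P.θ2m + P.θ1m) = P.θ1m - P.θ1p :=
  div_mul_cancel₀ _ (add_pos h.θ2m_pos h.θ1m_pos).ne'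

lemma cp_mul (h : P.Admissible) : P.cp * (P.θ2p + P.θ1p) = P.θ2p - P.θ2m :=
  div_mul_cancel₀ _ (add_pos h.θ2p_pos h.θ1p_pos).ne'

lemma cm_lt_one (h : P.Admissible) : P.cm < 1 :=
  (div_lt_one (add_pos h.θ2m_pos h.θ1m_pos)).2 (by linarith [h.θ2m_pos, h.θ1p_pos])

lemma cp_lt_one (h : P.Admissible) : P.cp < 1 :=
  (div_lt_one (add_pos h.θ2p_pos h.θ1p_pos)).2 (by linarith [h.θ2m_pos, h.θ1p_pos])

lemma gp_zero (h : P.Admissible) : P.gp 0 = Real.exp (-(P.θ2m * P.a)) := by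
  rw [gp, if_neg (not_lt.2 h.a_pos.le)]
  congr 1; ring

lemma gp_zero_pos (h : P.Admissible) : 0 < P.gp 0 := by
  rw [h.gp_zero]; exact Real.exp_pos _

lemma gm_zero (h : P.Admissible) :
    P.gm 0 = P.cm * P.gp 0 + (1 - P.cm) * Real.exp (P.θ1m * P.a) := by
  rw [gm, if_neg (not_lt.2 h.a_pos.le), h.gp_zero]
  congr 3 <;> ring_nf

/-- After division by g⁺(0), the only dependence on a is through exp((θ₁⁻ + θ₂⁻) a); the thresholds
a₂ and a₃ are obtained by solving for this exponential. -/
lemma gm_zero_eq (h : P.Admissible) : P.gm 0 =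
    P.gp 0 * (P.cm + (1 - P.cm) * Real.exp ((P.θ1m + P.θ2m) * P.a)) := by
  have : Real.exp (P.θ1m * P.a) = P.gp 0 * Real.exp ((P.θ1m + P.θ2m) * P.a) := by
    rw [h.gp_zero, ← Real.exp_add]; congr 1; ring
  rw [h.gm_zero, this]; ring

lemma gm_zero_pos (h : P.Admissible) : 0 < P.gm 0 := by
  rw [h.gm_zero_eq]
  have h1 : 1 ≤ Real.exp ((P.θ1m + P.θ2m) * P.a) :=
    Real.one_le_exp (mul_pos (add_pos h.θ1m_pos h.θ2m_pos) h.a_pos).le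
  exact mul_pos h.gp_zero_pos (by nlinarith [h.cm_lt_one])

end Admissible

/-! ### Closed forms of g and g' on the two sides of a -/

/-- The coefficient of the increasing exponential in `g` on `(a, ∞)`. -/
noncomputable def rightUp (P : Params) : ℝ := (1 - P.cp) * P.gm 0

/-- Minus the coefficient of the decreasing exponential in `g` on `(a, ∞)`. -/
noncomputable def rightDown (P : Params) : ℝ := P.gp 0 - P.cp * P.gm 0

/-- The coefficient of the increasing exponential in `g` on `(-∞, a]`. -/
noncomputable def leftUp (P : Params) : ℝ := P.gm 0 - P.cm * P.gp 0

/-- Minus the coefficient of the decreasing exponential in `g` on `(-∞, a]`. -/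
noncomputable def leftDown (P : Params) : ℝ := (1 - P.cm) * P.gp 0

lemma g_eq (x : ℝ) : P.g x =
    if P.a < x then P.rightUp * Real.exp (P.θ2p * (x - P.a)) +
      -P.rightDown * Real.exp (-P.θ1p * (x - P.a))
    else P.leftUp * Real.exp (P.θ2m * (x - P.a)) +
      -P.leftDown * Real.exp (-P.θ1m * (x - P.a)) := by
  rw [g]
  by_cases hx : P.a < x
  · rw [show P.gp x = _ from if_pos hx, show P.gm x = _ from if_pos hx, if_pos hx, rightUp, rightDown]
    ring
  · rw [show P.gp x = _ from if_neg hx, show P.gm x = _ from if_neg hx, if_neg hx, leftUp, leftDown]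
    ring

/-- `g'` on `[a, ∞)`. -/
noncomputable def rightDeriv (P : Params) (x : ℝ) : ℝ :=
  P.rightUp * P.θ2p * Real.exp (P.θ2p * (x - P.a)) +
    P.rightDown * P.θ1p * Real.exp (-P.θ1p * (x - P.a))

/-- `g'` on `(-∞, a]`. -/
noncomputable def leftDeriv (P : Params) (x : ℝ) : ℝ :=
  P.leftUp * P.θ2m * Real.exp (P.θ2m * (x - P.a)) +
    P.leftDown * P.θ1m * Real.exp (-P.θ1m * (x - P.a))

lemma hasDerivAt_rightDeriv (x : ℝ) : HasDerivAt P.rightDeriv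
    (P.rightUp * P.θ2p ^ 2 * Real.exp (P.θ2p * (x - P.a)) -
      P.rightDown * P.θ1p ^ 2 * Real.exp (-P.θ1p * (x - P.a))) x :=
  (hasDerivAt_two_exp (P.rightUp * P.θ2p) (P.rightDown * P.θ1p) P.θ2p P.θ1p P.a x).congr_deriv
    (by ring)

lemma hasDerivAt_leftDeriv (x : ℝ) : HasDerivAt P.leftDeriv
    (P.leftUp * P.θ2m ^ 2 * Real.exp (P.θ2m * (x - P.a)) -
      P.leftDown * P.θ1m ^ 2 * Real.exp (-P.θ1m * (x - P.a))) x :=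
  (hasDerivAt_two_exp (P.leftUp * P.θ2m) (P.leftDown * P.θ1m) P.θ2m P.θ1m P.a x).congr_deriv
    (by ring)

namespace Admissible

lemma rightUp_pos (h : P.Admissible) : 0 < P.rightUp :=
  mul_pos (sub_pos.2 h.cp_lt_one) h.gm_zero_pos

lemma leftDown_pos (h : P.Admissible) : 0 < P.leftDown :=
  mul_pos (sub_pos.2 h.cm_lt_one) h.gp_zero_pos

lemma leftUp_eq (h : P.Admissible) : P.leftUp = (1 - P.cm) * Real.exp (P.θ1m * P.a) := by
  rw [leftUp, h.gm_zero]; ring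

lemma leftUp_pos (h : P.Admissible) : 0 < P.leftUp := by
  rw [h.leftUp_eq]
  exact mul_pos (sub_pos.2 h.cm_lt_one) (Real.exp_pos _)

/-- The constants c₋ and c₊ are chosen precisely so that g⁻ and g⁺ are C¹ at a. -/
lemma rightDeriv_a (h : P.Admissible) : P.rightDeriv P.a = P.leftDeriv P.a := by
  simp only [rightDeriv, leftDeriv, rightUp, rightDown, leftUp, leftDown, sub_self, mul_zero,
    Real.exp_zero, mul_one]
  linear_combination (-P.gm 0) * h.cp_mul + P.gp 0 * h.cm_mul

lemma hasDerivAt_g_ite (h : P.Admissible) (x : ℝ) :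
    HasDerivAt P.g (if P.a < x then P.rightDeriv x else P.leftDeriv x) x := by
  have h0 : P.g = fun x => _ := funext P.g_eq
  rw [h0]
  refine hasDerivAt_glue
    (f := fun x => P.rightUp * Real.exp (P.θ2p * (x - P.a)) +
      -P.rightDown * Real.exp (-P.θ1p * (x - P.a)))
    (k := fun x => P.leftUp * Real.exp (P.θ2m * (x - P.a)) +
      -P.leftDown * Real.exp (-P.θ1m * (x - P.a)))
    (fun x => (hasDerivAt_two_exp _ _ _ _ _ x).congr_deriv (by rw [rightDeriv]; ring))
    (fun x => (hasDerivAt_two_exp _ _ _ _ _ x).congr_deriv (by rw [leftDeriv]; ring))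
    ?_ h.rightDeriv_a x
  simp only [rightUp, rightDown, leftUp, leftDown, sub_self, mul_zero, Real.exp_zero, mul_one]
  ring

lemma g'_eq (h : P.Admissible) (x : ℝ) :
    P.g' x = if P.a < x then P.rightDeriv x else P.leftDeriv x :=
  (h.hasDerivAt_g_ite x).deriv

lemma hasDerivAt_g (h : P.Admissible) (x : ℝ) : HasDerivAt P.g (P.g' x) x := by
  rw [h.g'_eq]; exact h.hasDerivAt_g_ite x

lemma g'_of_le (h : P.Admissible) {x : ℝ} (hx : x ≤ P.a) : P.g' x = P.leftDeriv x := by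
  rw [h.g'_eq, if_neg (not_lt.2 hx)]

lemma g'_of_ge (h : P.Admissible) {x : ℝ} (hx : P.a ≤ x) : P.g' x = P.rightDeriv x := by
  rcases eq_or_lt_of_le hx with rfl | hx
  · rw [h.g'_of_le le_rfl, h.rightDeriv_a]
  · rw [h.g'_eq, if_pos hx]

lemma continuous_g' (h : P.Admissible) : Continuous P.g' := by
  have h0 : P.g' = fun x => if x ≤ P.a then P.leftDeriv x else P.rightDeriv x := by
    funext x
    split_ifs with hx
    · exact h.g'_of_le hx
    · exact h.g'_of_ge (not_le.1 hx).le
  rw [h0]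
  refine Continuous.if_le ?_ ?_ continuous_id continuous_const ?_
  · exact continuous_iff_continuousAt.2 fun x => (hasDerivAt_leftDeriv x).continuousAt
  · exact continuous_iff_continuousAt.2 fun x => (hasDerivAt_rightDeriv x).continuousAt
  · rintro x rfl; exact h.rightDeriv_a.symm

lemma leftDeriv_pos (h : P.Admissible) (x : ℝ) : 0 < P.leftDeriv x := by
  have := h.leftUp_pos; have := h.leftDown_pos; have := h.θ1m_pos; have := h.θ2m_pos
  rw [leftDeriv]; positivity

/-- Right of a the coefficient `rightDown` may be negative. Then both terms of g' are at least their
values at a, where the sum is positive by the left formula. -/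
lemma g'_pos (h : P.Admissible) (x : ℝ) : 0 < P.g' x := by
  rcases le_total x P.a with hx | hx
  · rw [h.g'_of_le hx]; exact h.leftDeriv_pos x
  · rw [h.g'_of_ge hx]
    have hA := h.rightUp_pos; have hs := h.θ2p_pos; have ht := h.θ1p_pos
    have h1 : 1 ≤ Real.exp (P.θ2p * (x - P.a)) :=
      Real.one_le_exp (mul_nonneg hs.le (sub_nonneg.2 hx))
    have h2 : Real.exp (-P.θ1p * (x - P.a)) ≤ 1 :=
      Real.exp_le_one_iff.2 (by have := mul_nonneg ht.le (sub_nonneg.2 hx); linarith)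
    have h3 := Real.exp_pos (-P.θ1p * (x - P.a))
    have hpos : 0 < P.rightUp * P.θ2p + P.rightDown * P.θ1p := by
      have := h.leftDeriv_pos P.a
      rw [← h.rightDeriv_a, rightDeriv] at this
      simpa using this
    rw [rightDeriv]
    have hAs := mul_pos hA hs
    rcases le_total 0 (P.rightDown * P.θ1p) with hB | hB
    · nlinarith [mul_nonneg hB h3.le]
    · nlinarith

/-! ### Monotonicity of g' and the meaning of the thresholds -/

lemma strictMonoOn_g'_left (h : P.Admissible) : StrictMonoOn P.g' (Icc 0 P.a) := by
  have key : StrictMonoOn P.leftDeriv (Icc 0 P.a) := by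
    refine strictMonoOn_of_deriv_pos (convex_Icc _ _)
      (fun x _ => (hasDerivAt_leftDeriv x).continuousAt.continuousWithinAt) fun x hx => ?_
    rw [interior_Icc] at hx
    rw [(hasDerivAt_leftDeriv x).deriv, sub_pos, h.leftUp_eq, leftDown, h.gp_zero]
    have e1 : (1 - P.cm) * Real.exp (P.θ1m * P.a) * P.θ2m ^ 2 * Real.exp (P.θ2m * (x - P.a)) =
        (1 - P.cm) * (P.θ2m ^ 2 * Real.exp (P.θ1m * P.a - P.θ2m * P.a + P.θ2m * x)) := by
      rw [show P.θ1m * P.a - P.θ2m * P.a + P.θ2m * x = P.θ1m * P.a + P.θ2m * (x - P.a) by ring,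
        Real.exp_add]
      ring
    have e2 : (1 - P.cm) * Real.exp (-(P.θ2m * P.a)) * P.θ1m ^ 2 *
        Real.exp (-P.θ1m * (x - P.a)) =
        (1 - P.cm) * (P.θ1m ^ 2 * Real.exp (P.θ1m * P.a - P.θ2m * P.a - P.θ1m * x)) := by
      rw [show P.θ1m * P.a - P.θ2m * P.a - P.θ1m * x =
        -(P.θ2m * P.a) + -P.θ1m * (x - P.a) by ring, Real.exp_add]
      ring
    rw [e1, e2]
    -- What remains is (θ₁⁻)² e^(-θ₁⁻ x) < (θ₂⁻)² e^(θ₂⁻ x) up to a common factor. It holds for x >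
    -- 0 because θ₁⁻ ≤ θ₂⁻, which is where μ₋ ≤ 0 enters.
    refine mul_lt_mul_of_pos_left ?_ (sub_pos.2 h.cm_lt_one)
    refine mul_lt_mul' (pow_le_pow_left₀ h.θ1m_pos.le h.θ1m_le_θ2m 2) (Real.exp_lt_exp.2 ?_)
      (Real.exp_pos _).le (pow_pos h.θ2m_pos 2)
    have := mul_pos h.θ1m_pos hx.1
    have := mul_pos h.θ2m_pos hx.1
    linarith
  exact key.congr fun x hx => (h.g'_of_le hx.2).symm

/-- The sign of the second derivative of `g` on `(a, ∞)`. -/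
lemma rightDeriv_deriv_pos_iff (x : ℝ) :
    0 < P.rightUp * P.θ2p ^ 2 * Real.exp (P.θ2p * (x - P.a)) -
      P.rightDown * P.θ1p ^ 2 * Real.exp (-P.θ1p * (x - P.a)) ↔
    P.rightDown * P.θ1p ^ 2 <
      P.rightUp * P.θ2p ^ 2 * Real.exp ((P.θ2p + P.θ1p) * (x - P.a)) := by
  have e : P.rightUp * P.θ2p ^ 2 * Real.exp (P.θ2p * (x - P.a)) =
      P.rightUp * P.θ2p ^ 2 * Real.exp ((P.θ2p + P.θ1p) * (x - P.a)) *
        Real.exp (-P.θ1p * (x - P.a)) := by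
    rw [mul_assoc _ (Real.exp _), ← Real.exp_add]; congr 2; ring
  rw [e, sub_pos, mul_lt_mul_iff_left₀ (Real.exp_pos _)]

lemma rightDeriv_deriv_neg_iff (x : ℝ) :
    P.rightUp * P.θ2p ^ 2 * Real.exp (P.θ2p * (x - P.a)) -
      P.rightDown * P.θ1p ^ 2 * Real.exp (-P.θ1p * (x - P.a)) < 0 ↔
    P.rightUp * P.θ2p ^ 2 * Real.exp ((P.θ2p + P.θ1p) * (x - P.a)) <
      P.rightDown * P.θ1p ^ 2 := by
  have e : P.rightUp * P.θ2p ^ 2 * Real.exp (P.θ2p * (x - P.a)) =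
      P.rightUp * P.θ2p ^ 2 * Real.exp ((P.θ2p + P.θ1p) * (x - P.a)) *
        Real.exp (-P.θ1p * (x - P.a)) := by
    rw [mul_assoc _ (Real.exp _), ← Real.exp_add]; congr 2; ring
  rw [e, sub_neg, mul_lt_mul_iff_left₀ (Real.exp_pos _)]

/-- The second derivative has the sign of an increasing exponential minus a constant, so once it is
nonnegative it is positive from there on. -/
lemma strictMonoOn_g'_of_le (h : P.Admissible) {b : ℝ} (hb : P.a ≤ b)
    (hB : P.rightDown * P.θ1p ^ 2 ≤
      P.rightUp * P.θ2p ^ 2 * Real.exp ((P.θ2p + P.θ1p) * (b - P.a))) :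
    StrictMonoOn P.g' (Ici b) := by
  have key : StrictMonoOn P.rightDeriv (Ici b) := by
    refine strictMonoOn_of_deriv_pos (convex_Ici _)
      (fun x _ => (hasDerivAt_rightDeriv x).continuousAt.continuousWithinAt) fun x hx => ?_
    rw [interior_Ici] at hx
    rw [(hasDerivAt_rightDeriv x).deriv, rightDeriv_deriv_pos_iff]
    refine hB.trans_lt (mul_lt_mul_of_pos_left (Real.exp_lt_exp.2 ?_)
      (mul_pos h.rightUp_pos (pow_pos h.θ2p_pos 2)))
    exact mul_lt_mul_of_pos_left (sub_lt_sub_right hx _) (add_pos h.θ2p_pos h.θ1p_pos)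
  exact key.congr fun x hx => (h.g'_of_ge (hb.trans hx)).symm

lemma strictAntiOn_g'_of_le (h : P.Admissible) {b : ℝ}
    (hB : P.rightUp * P.θ2p ^ 2 * Real.exp ((P.θ2p + P.θ1p) * (b - P.a)) ≤
      P.rightDown * P.θ1p ^ 2) :
    StrictAntiOn P.g' (Icc P.a b) := by
  have key : StrictAntiOn P.rightDeriv (Icc P.a b) := by
    refine strictAntiOn_of_deriv_neg (convex_Icc _ _)
      (fun x _ => (hasDerivAt_rightDeriv x).continuousAt.continuousWithinAt) fun x hx => ?_
    rw [interior_Icc] at hx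
    rw [(hasDerivAt_rightDeriv x).deriv, rightDeriv_deriv_neg_iff]
    refine lt_of_lt_of_le (mul_lt_mul_of_pos_left (Real.exp_lt_exp.2 ?_)
      (mul_pos h.rightUp_pos (pow_pos h.θ2p_pos 2))) hB
    exact mul_lt_mul_of_pos_left (sub_lt_sub_right hx.2 _) (add_pos h.θ2p_pos h.θ1p_pos)
  exact key.congr fun x hx => (h.g'_of_ge hx.1).symm

lemma tendsto_g' (h : P.Admissible) : Tendsto P.g' atTop atTop := by
  have hu : Tendsto (fun x => P.θ2p * (x - P.a)) atTop atTop :=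
    (tendsto_atTop_add_const_right _ (-P.a) tendsto_id).const_mul_atTop h.θ2p_pos
  have h1 := (Real.tendsto_exp_atTop.comp hu).const_mul_atTop
    (mul_pos h.rightUp_pos h.θ2p_pos)
  have h2 := tendsto_atTop_add_const_right _ (-|P.rightDown * P.θ1p|) h1
  refine tendsto_atTop_mono' _ ?_ h2
  filter_upwards [eventually_ge_atTop P.a] with x hx
  rw [h.g'_of_ge hx, rightDeriv]
  have h3 : Real.exp (-P.θ1p * (x - P.a)) ≤ 1 :=
    Real.exp_le_one_iff.2 (by have := mul_nonneg h.θ1p_pos.le (sub_nonneg.2 hx); linarith)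
  have h4 : |P.rightDown * P.θ1p * Real.exp (-P.θ1p * (x - P.a))| ≤ |P.rightDown * P.θ1p| := by
    rw [abs_mul, abs_of_pos (Real.exp_pos _)]
    exact mul_le_of_le_one_right (abs_nonneg _) h3
  have := (abs_le.1 h4).1
  simp only [Function.comp]
  linarith

/-- Whether `g'` starts increasing or decreasing at `a` is decided by the sign of this
combination. -/
lemma rightDown_sub_rightUp (h : P.Admissible) :
    P.rightDown * P.θ1p ^ 2 - P.rightUp * P.θ2p ^ 2 = P.gp 0 * (P.θ1p ^ 2 -
      (P.cm + (1 - P.cm) * Real.exp ((P.θ1m + P.θ2m) * P.a)) * P.Θ) := by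
  rw [rightDown, rightUp, Θ, h.gm_zero_eq]; ring

lemma Θ_lt (h : P.Admissible) : P.Θ < P.θ1p ^ 2 := by
  have h1 : P.θ2p ^ 2 < P.θ1p ^ 2 := pow_lt_pow_left₀ h.θ2p_lt_θ1p h.θ2p_pos.le two_ne_zero
  rw [Θ]; nlinarith [h.cp_lt_one]

lemma Θ_pos (h : P.Admissible) (hc : 0 < P.cp) : 0 < P.Θ :=
  add_pos (mul_pos hc (pow_pos h.θ1p_pos 2))
    (mul_pos (sub_pos.2 h.cp_lt_one) (pow_pos h.θ2p_pos 2))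

/-- a₃ is the value of a at which the right second derivative of g at a vanishes; by
`rightDown_sub_rightUp` that condition is affine in exp((θ₁⁻ + θ₂⁻) a). -/
lemma a3_le_iff (h : P.Admissible) (hΘ : 0 < P.Θ) : P.a3 ≤ P.a ↔
    P.rightDown * P.θ1p ^ 2 ≤ P.rightUp * P.θ2p ^ 2 := by
  have hnum : (1 - P.cm * P.cp) * P.θ1p ^ 2 - (1 - P.cp) * P.cm * P.θ2p ^ 2 =
      P.θ1p ^ 2 - P.cm * P.Θ := by rw [Θ]; ring
  have hpos : 0 < P.θ1p ^ 2 - P.cm * P.Θ := by nlinarith [h.cm_lt_one, h.Θ_lt]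
  have hden : 0 < (1 - P.cm) * P.Θ := mul_pos (sub_pos.2 h.cm_lt_one) hΘ
  rw [← sub_nonpos (a := P.rightDown * P.θ1p ^ 2), h.rightDown_sub_rightUp,
    mul_nonpos_iff_pos_imp_nonpos, a3, div_le_iff₀ (add_pos h.θ1m_pos h.θ2m_pos), hnum,
    Real.log_le_iff_le_exp (div_pos hpos hden), div_le_iff₀ hden, mul_comm P.a]
  have := h.gp_zero_pos
  constructor
  · intro h1; exact ⟨fun _ => by linarith, fun _ => this.le⟩
  · intro h1; have := h1.1 this; linarith

/-- a₂ is the threshold past which the decreasing exponential of g' on (a, ∞) has a nonpositive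
coefficient, so that g' increases there regardless of a₃. -/
lemma rightDown_nonpos_of_a2_le (h : P.Admissible) (hc : 0 < P.cp) (ha : P.a2 ≤ P.a) :
    P.rightDown ≤ 0 := by
  have hd : 0 < P.θ2p - P.θ2m := by
    rw [← h.cp_mul]; exact mul_pos hc (add_pos h.θ2p_pos h.θ1p_pos)
  rw [a2, div_le_iff₀ (add_pos h.θ1m_pos h.θ2m_pos),
    Real.log_le_iff_le_exp (div_pos (add_pos h.θ2p_pos h.θ1m_pos) hd), div_le_iff₀ hd,
    mul_comm P.a] at ha
  rw [rightDown, h.gm_zero_eq]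
  have key : 1 ≤ P.cp * (P.cm + (1 - P.cm) * Real.exp ((P.θ1m + P.θ2m) * P.a)) := by
    set E := Real.exp ((P.θ1m + P.θ2m) * P.a)
    have hs : 0 < P.θ2p + P.θ1p := add_pos h.θ2p_pos h.θ1p_pos
    have ht : 0 < P.θ2m + P.θ1m := add_pos h.θ2m_pos h.θ1m_pos
    -- Multiplying by the denominators of c₊ and c₋ makes the claim linear in E, with equality
    -- exactly when the bound `ha` is an equality.
    have h1 : (P.θ2p + P.θ1p) * (P.θ2m + P.θ1m) ≤ (P.cp * (P.cm + (1 - P.cm) * E)) *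
        ((P.θ2p + P.θ1p) * (P.θ2m + P.θ1m)) := by
      have e : (P.cp * (P.cm + (1 - P.cm) * E)) * ((P.θ2p + P.θ1p) * (P.θ2m + P.θ1m)) =
          (P.θ2p - P.θ2m) * ((P.θ1m - P.θ1p) + (P.θ2m + P.θ1p) * E) := by
        rw [← h.cp_mul, show P.θ2m + P.θ1p = (P.θ2m + P.θ1m) - (P.θ1m - P.θ1p) by ring,
          ← h.cm_mul]
        ring
      rw [e]
      nlinarith [mul_le_mul_of_nonneg_left ha (add_pos h.θ2m_pos h.θ1p_pos).le]
    have h2 := mul_pos hs ht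
    nlinarith
  nlinarith [h.gp_zero_pos]

/-- x₀ is the zero of the second derivative of g on the right branch. -/
lemma exp_x0 (h : P.Admissible) (hB : P.rightUp * P.θ2p ^ 2 < P.rightDown * P.θ1p ^ 2) :
    P.rightUp * P.θ2p ^ 2 * Real.exp ((P.θ2p + P.θ1p) * (P.x0 - P.a)) =
      P.rightDown * P.θ1p ^ 2 := by
  have hA : 0 < P.rightUp * P.θ2p ^ 2 := mul_pos h.rightUp_pos (pow_pos h.θ2p_pos 2)
  have hx : (P.θ2p + P.θ1p) * (P.x0 - P.a) =
      Real.log ((P.rightDown * P.θ1p ^ 2) / (P.rightUp * P.θ2p ^ 2)) := by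
    rw [x0, add_sub_cancel_right, mul_div_cancel₀ _ (add_pos h.θ2p_pos h.θ1p_pos).ne']
    rfl
  rw [hx, Real.exp_log (div_pos (hA.trans hB) hA), mul_div_cancel₀ _ hA.ne']

lemma a_lt_x0 (h : P.Admissible) (hB : P.rightUp * P.θ2p ^ 2 < P.rightDown * P.θ1p ^ 2) :
    P.a < P.x0 := by
  have hA : 0 < P.rightUp * P.θ2p ^ 2 := mul_pos h.rightUp_pos (pow_pos h.θ2p_pos 2)
  have h1 : 1 < Real.exp ((P.θ2p + P.θ1p) * (P.x0 - P.a)) := by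
    by_contra hcon
    have := h.exp_x0 hB
    nlinarith
  have h2 := Real.one_lt_exp_iff.1 h1
  exact sub_pos.1 (pos_of_mul_pos_right h2 (add_pos h.θ2p_pos h.θ1p_pos).le)

lemma rightDown_le_of_caseI (h : P.Admissible) (hc : P.CaseI) :
    P.rightDown * P.θ1p ^ 2 ≤ P.rightUp * P.θ2p ^ 2 := by
  rcases hc with ⟨hc, ha⟩ | ⟨hc, -, ha, -⟩ | ⟨-, ha, hΘ⟩
  · have h1 := h.rightDown_nonpos_of_a2_le hc ha
    exact (mul_nonpos_of_nonpos_of_nonneg h1 (sq_nonneg _)).trans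
      (mul_pos h.rightUp_pos (pow_pos h.θ2p_pos 2)).le
  · exact (h.a3_le_iff (h.Θ_pos hc)).1 ha
  · exact (h.a3_le_iff hΘ).1 ha

lemma lt_rightDown_of_caseII (h : P.Admissible) (hc : P.CaseII) :
    P.rightUp * P.θ2p ^ 2 < P.rightDown * P.θ1p ^ 2 := by
  rcases hc with ⟨hc, -, ha⟩ | ⟨-, hΘ⟩ | ⟨-, -, ha, hΘ⟩
  · exact not_le.1 fun hn => absurd ((h.a3_le_iff (h.Θ_pos hc)).2 hn)
      (not_le.2 (ha.trans_le (min_le_right _ _)))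
  -- With Θ ≤ 0 the bracket is at least (θ₁⁺)², whatever a is.
  · rw [← sub_pos, h.rightDown_sub_rightUp]
    have h1 : 1 ≤ Real.exp ((P.θ1m + P.θ2m) * P.a) :=
      Real.one_le_exp (mul_pos (add_pos h.θ1m_pos h.θ2m_pos) h.a_pos).le
    have h2 : 0 ≤ P.cm + (1 - P.cm) * Real.exp ((P.θ1m + P.θ2m) * P.a) := by
      nlinarith [h.cm_lt_one]
    exact mul_pos h.gp_zero_pos (by nlinarith [pow_pos h.θ1p_pos 2])
  · exact not_le.1 fun hn => absurd ((h.a3_le_iff hΘ).2 hn) (not_le.2 ha)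

end Admissible

/-! ### The shapes of g' used from here on -/

/-- The properties of `g` that hold in both cases. -/
structure Regular (P : Params) : Prop where
  hasDerivAt_g : ∀ x, HasDerivAt P.g (P.g' x) x
  continuous_g' : Continuous P.g'
  g'_pos : ∀ x, 0 < P.g' x
  tendsto_g' : Tendsto P.g' atTop atTop

/-- The shape of `g'` in Case (ii): increasing, then decreasing, then increasing. -/
structure ThreePhase (P : Params) : Prop extends Regular P where
  a_pos : 0 < P.a
  a_lt_x0 : P.a < P.x0
  mono_left : StrictMonoOn P.g' (Icc 0 P.a)
  anti_mid : StrictAntiOn P.g' (Icc P.a P.x0)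
  mono_right : StrictMonoOn P.g' (Ici P.x0)

namespace Admissible

lemma regular (h : P.Admissible) : P.Regular :=
  ⟨h.hasDerivAt_g, h.continuous_g', h.g'_pos, h.tendsto_g'⟩

lemma strictMonoOn_g'_of_caseI (h : P.Admissible) (hc : P.CaseI) :
    StrictMonoOn P.g' (Ici 0) := by
  have h1 : StrictMonoOn P.g' (Ici P.a) := h.strictMonoOn_g'_of_le le_rfl
    (by simpa using h.rightDown_le_of_caseI hc)
  rw [← Icc_union_Ici_eq_Ici h.a_pos.le]
  exact h.strictMonoOn_g'_left.union h1 (isGreatest_Icc h.a_pos.le) isLeast_Ici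

lemma threePhase (h : P.Admissible) (hc : P.CaseII) : P.ThreePhase where
  toRegular := h.regular
  a_pos := h.a_pos
  a_lt_x0 := h.a_lt_x0 (h.lt_rightDown_of_caseII hc)
  mono_left := h.strictMonoOn_g'_left
  anti_mid := h.strictAntiOn_g'_of_le (h.exp_x0 (h.lt_rightDown_of_caseII hc)).le
  mono_right := h.strictMonoOn_g'_of_le (h.a_lt_x0 (h.lt_rightDown_of_caseII hc)).le
    (h.exp_x0 (h.lt_rightDown_of_caseII hc)).ge

end Admissible

/-! ### Tilts and the level method for the quotient -/

/-- `v x - g(x)`, the primitive of `v - g'`. -/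
noncomputable def tilt (P : Params) (v x : ℝ) : ℝ := v * x - P.g x

/-- Changing the level adds a linear term, so raising it favours points further right and lowering
it favours points further left. Comparisons are carried between levels in this way. -/
lemma tilt_sub_tilt (v w x : ℝ) : P.tilt v x = P.tilt w x + (v - w) * x := by
  rw [tilt, tilt]; ring

lemma tilt_zero (v w : ℝ) : P.tilt v 0 = P.tilt w 0 := by
  rw [tilt, tilt]; ring

namespace Regular

lemma hasDerivAt_tilt (h : P.Regular) (v x : ℝ) : HasDerivAt (P.tilt v) (v - P.g' x) x :=
  (((hasDerivAt_id x).const_mul v).sub (h.hasDerivAt_g x)).congr_deriv (by simp)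

lemma continuous_g (h : P.Regular) : Continuous P.g :=
  continuous_iff_continuousAt.2 fun x => (h.hasDerivAt_g x).continuousAt

lemma continuous_tilt (h : P.Regular) (v : ℝ) : Continuous (P.tilt v) :=
  continuous_iff_continuousAt.2 fun x => (h.hasDerivAt_tilt v x).continuousAt

lemma strictMono_g (h : P.Regular) : StrictMono P.g :=
  strictMono_of_deriv_pos fun x => by rw [(h.hasDerivAt_g x).deriv]; exact h.g'_pos x

/-- This turns every integral in the definitions into a normalized tilt increment. -/
lemma integral_one_sub (h : P.Regular) {v : ℝ} (hv : 0 < v) (x y : ℝ) :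
    ∫ s in x..y, (1 - P.g' s / v) = (P.tilt v y - P.tilt v x) / v := by
  have h1 : ∀ s ∈ uIcc x y, HasDerivAt (fun s => P.tilt v s / v) (1 - P.g' s / v) s := fun s _ =>
    ((h.hasDerivAt_tilt v s).div_const v).congr_deriv (by field_simp)
  rw [intervalIntegral.integral_eq_sub_of_hasDerivAt h1, sub_div]
  exact (continuous_const.sub (h.continuous_g'.div_const v)).intervalIntegrable _ _

lemma tilt_lt_of_g'_lt (h : P.Regular) {v x y : ℝ} (hxy : x < y)
    (hv : ∀ s ∈ Ioo x y, P.g' s < v) : P.tilt v x < P.tilt v y := by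
  refine strictMonoOn_of_deriv_pos (convex_Icc x y) (h.continuous_tilt v).continuousOn
    (fun s hs => ?_) (left_mem_Icc.2 hxy.le) (right_mem_Icc.2 hxy.le) hxy
  rw [interior_Icc] at hs
  rw [(h.hasDerivAt_tilt v s).deriv]
  exact sub_pos.2 (hv s hs)

lemma tilt_lt_of_lt_g' (h : P.Regular) {v x y : ℝ} (hxy : x < y)
    (hv : ∀ s ∈ Ioo x y, v < P.g' s) : P.tilt v y < P.tilt v x := by
  refine strictAntiOn_of_deriv_neg (convex_Icc x y) (h.continuous_tilt v).continuousOn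
    (fun s hs => ?_) (left_mem_Icc.2 hxy.le) (right_mem_Icc.2 hxy.le) hxy
  rw [interior_Icc] at hs
  rw [(h.hasDerivAt_tilt v s).deriv]
  exact sub_neg.2 (hv s hs)

/-- Where `g'` increases, the tilt is strictly quasiconcave. -/
lemma min_lt_tilt (h : P.Regular) {v x y z : ℝ} (hm : StrictMonoOn P.g' (Icc x z))
    (hxy : x < y) (hyz : y < z) : min (P.tilt v x) (P.tilt v z) < P.tilt v y := by
  rcases le_total (P.g' y) v with hv | hv
  · refine (min_le_left _ _).trans_lt (h.tilt_lt_of_g'_lt hxy fun s hs => ?_)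
    exact (hm ⟨hs.1.le, (hs.2.trans hyz).le⟩ ⟨hxy.le, hyz.le⟩ hs.2).trans_le hv
  · refine (min_le_right _ _).trans_lt (h.tilt_lt_of_lt_g' hyz fun s hs => ?_)
    exact hv.trans_lt (hm ⟨hxy.le, hyz.le⟩ ⟨(hxy.trans hs.1).le, hs.2.le⟩ hs.1)

/-- Where `g'` decreases, the tilt is strictly quasiconvex. -/
lemma tilt_lt_max (h : P.Regular) {v x y z : ℝ} (hm : StrictAntiOn P.g' (Icc x z))
    (hxy : x < y) (hyz : y < z) : P.tilt v y < max (P.tilt v x) (P.tilt v z) := by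
  rcases le_total (P.g' y) v with hv | hv
  · refine (h.tilt_lt_of_g'_lt hyz fun s hs => ?_).trans_le (le_max_right _ _)
    exact (hm ⟨hxy.le, hyz.le⟩ ⟨(hxy.trans hs.1).le, hs.2.le⟩ hs.1).trans_le hv
  · refine (h.tilt_lt_of_lt_g' hxy fun s hs => ?_).trans_le (le_max_left _ _)
    exact hv.trans_lt (hm ⟨hs.1.le, (hs.2.trans hyz).le⟩ ⟨hxy.le, hyz.le⟩ hs.2)

/-- Raising the level increases the normalized increment of the tilt. -/
lemma tilt_div_lt (h : P.Regular) {v w x y : ℝ} (hv : 0 < v) (hvw : v < w) (hxy : x < y) :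
    (P.tilt v y - P.tilt v x) / v < (P.tilt w y - P.tilt w x) / w := by
  have hg : 0 < P.g y - P.g x := sub_pos.2 (h.strictMono_g hxy)
  have hw := hv.trans hvw
  have e : ∀ u : ℝ, 0 < u →
      (P.tilt u y - P.tilt u x) / u = (y - x) - (P.g y - P.g x) / u := by
    intro u hu; rw [tilt, tilt]; field_simp; ring
  rw [e v hv, e w hw]
  exact sub_lt_sub_left (div_lt_div_of_pos_left hg hv hvw) _

/-- A bound for a tilt increment at a level is strict at every lower level. -/
lemma tilt_sub_lt_of_lt (h : P.Regular) {v w x y β : ℝ} (hβ : 0 < β) (hv : 0 < v) (hvw : v < w)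
    (hxy : x ≤ y) (hw : P.tilt w y - P.tilt w x ≤ β * w) :
    P.tilt v y - P.tilt v x < β * v := by
  rcases eq_or_lt_of_le hxy with rfl | hxy
  · rw [sub_self]; exact mul_pos hβ hv
  · rw [← div_lt_iff₀ hv]
    exact (h.tilt_div_lt hv hvw hxy).trans_le ((div_le_iff₀ (hv.trans hvw)).2 hw)

/-- The maximizers of `ζ` are the maximizers of the tilt increment at the level where its maximum
equals `β v`. -/
lemma Mζ_eq (h : P.Regular) {β v : ℝ} (hβ : 0 < β) (hv : 0 < v)
    (hle : ∀ x y, 0 ≤ x → x ≤ y → P.tilt v y - P.tilt v x ≤ β * v)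
    (hex : ∃ x y, 0 ≤ x ∧ x ≤ y ∧ P.tilt v y - P.tilt v x = β * v) :
    P.Mζ β = {z | 0 ≤ z.1 ∧ z.1 ≤ z.2 ∧ P.tilt v z.2 - P.tilt v z.1 = β * v} := by
  have hζ : ∀ z ∈ Dζ β, P.ζ β z ≤ 1 / v := by
    rintro z ⟨h1, h2, h3⟩
    have hlt : z.1 < z.2 := by linarith
    have hg := sub_pos.2 (h.strictMono_g hlt)
    rw [ζ, div_le_div_iff₀ hg hv]
    have := hle z.1 z.2 h1 hlt.le
    simp only [tilt] at this
    linarith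
  have hζeq : ∀ z ∈ Dζ β, (P.ζ β z = 1 / v ↔ P.tilt v z.2 - P.tilt v z.1 = β * v) := by
    rintro z ⟨h1, h2, h3⟩
    have hlt : z.1 < z.2 := by linarith
    have hg := sub_pos.2 (h.strictMono_g hlt)
    rw [ζ, div_eq_div_iff hg.ne' hv.ne', tilt, tilt]
    constructor <;> intro h' <;> linarith
  -- The constraint x + β ≤ y is automatic: v (y - x - β) = g(y) - g(x) ≥ 0.
  have hmem : ∀ x y, 0 ≤ x → x ≤ y → P.tilt v y - P.tilt v x = β * v → (x, y) ∈ Dζ β := by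
    intro x y hx hxy he
    refine ⟨hx, hx.trans hxy, ?_⟩
    have hg := h.strictMono_g.monotone hxy
    simp only [tilt] at he
    have : 0 ≤ v * (y - x - β) := by linarith
    have := nonneg_of_mul_nonneg_right this hv
    simp only; linarith
  obtain ⟨x, y, hx, hxy, he⟩ := hex
  have hD := hmem x y hx hxy he
  ext z
  constructor
  · rintro ⟨hz, hmax⟩
    refine ⟨hz.1, by linarith [hz.2.2], (hζeq z hz).1 (le_antisymm (hζ z hz) ?_)⟩
    rw [← (hζeq (x, y) hD).2 he]
    exact hmax _ hD
  · rintro ⟨h1, h2, h3⟩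
    have hz : z ∈ Dζ β := hmem z.1 z.2 h1 h2 h3
    refine ⟨hz, fun w hw => ?_⟩
    rw [(hζeq z hz).2 h3]
    exact hζ w hw

/-- First-order condition at the right end of an optimal interval. -/
lemma g'_right_eq (h : P.Regular) {v x y : ℝ} (hxy : x < y)
    (hmax : ∀ y', x ≤ y' → P.tilt v y' ≤ P.tilt v y) : P.g' y = v := by
  have h1 : IsLocalMax (P.tilt v) y := by
    filter_upwards [lt_mem_nhds hxy] with y' hy' using hmax y' hy'.le
  have := h1.hasDerivAt_eq_zero (h.hasDerivAt_tilt v y)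
  linarith

/-- First-order condition at the left end of an optimal interval. -/
lemma g'_left_eq (h : P.Regular) {v x y : ℝ} (hx : 0 < x) (hxy : x < y)
    (hmin : ∀ x', 0 ≤ x' → x' ≤ y → P.tilt v x ≤ P.tilt v x') : P.g' x = v := by
  have h1 : IsLocalMin (P.tilt v) x := by
    filter_upwards [lt_mem_nhds hx, gt_mem_nhds hxy] with x' h1 h2 using hmin x' h1.le h2.le
  have := h1.hasDerivAt_eq_zero (h.hasDerivAt_tilt v x)
  linarith

/-! ### The function ω₃ on intervals where g' increases -/

lemma ω3_eq (h : P.Regular) (x : ℝ) :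
    P.ω3 x = (P.tilt (P.g' x) x - P.tilt (P.g' x) 0) / P.g' x :=
  h.integral_one_sub (h.g'_pos x) 0 x

lemma ω3_eq_iff (h : P.Regular) (x β : ℝ) :
    P.ω3 x = β ↔ P.tilt (P.g' x) x - P.tilt (P.g' x) 0 = β * P.g' x := by
  rw [h.ω3_eq, div_eq_iff (h.g'_pos x).ne']

lemma ω3_zero (h : P.Regular) : P.ω3 0 = 0 := by
  rw [h.ω3_eq, sub_self, zero_div]

lemma continuous_ω3 (h : P.Regular) : Continuous P.ω3 := by
  have h0 : P.ω3 = fun x => (P.g' x * x - P.g x - (P.g' x * 0 - P.g 0)) / P.g' x :=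
    funext h.ω3_eq
  rw [h0]
  have h1 := h.continuous_g'
  have h2 := h.continuous_g
  exact Continuous.div (by fun_prop) h1 fun x => (h.g'_pos x).ne'

/-- `ω₃` increases wherever `g'` does. -/
lemma ω3_lt (h : P.Regular) {x y : ℝ} (hx : 0 ≤ x) (hxy : x < y)
    (hm : StrictMonoOn P.g' (Icc x y)) : P.ω3 x < P.ω3 y := by
  have hg := hm (left_mem_Icc.2 hxy.le) (right_mem_Icc.2 hxy.le) hxy
  -- The passage from x to y is split in two: move the end point at the level g'(y), then change the
  -- level with the end point x fixed.
  have hT : P.tilt (P.g' y) x < P.tilt (P.g' y) y :=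
    h.tilt_lt_of_g'_lt hxy fun s hs =>
      hm ⟨hs.1.le, hs.2.le⟩ (right_mem_Icc.2 hxy.le) hs.2
  rw [h.ω3_eq, h.ω3_eq]
  refine lt_of_le_of_lt ?_ (div_lt_div_of_pos_right (sub_lt_sub_right hT _) (h.g'_pos y))
  rcases eq_or_lt_of_le hx with rfl | hx
  · simp
  · exact (h.tilt_div_lt (h.g'_pos x) hg hx).le

lemma strictMonoOn_ω3 (h : P.Regular) {s : Set ℝ} (hs : s.OrdConnected) (h0 : ∀ x ∈ s, 0 ≤ x)
    (hm : StrictMonoOn P.g' s) : StrictMonoOn P.ω3 s := fun x hx _ hy hxy =>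
  h.ω3_lt (h0 x hx) hxy (hm.mono (hs.out hx hy))

/-- `ω₃` is unbounded. -/
lemma exists_le_ω3 (h : P.Regular) {b : ℝ} (hm : StrictMonoOn P.g' (Ici b))
    (C : ℝ) : ∃ x, b ≤ x ∧ C ≤ P.ω3 x := by
  -- At a level v ≥ g(N) - g(0), the increment over [0, N] is at least (C + 1) v - v = C v, and
  -- extending the interval to x only increases it.
  set N := max b (C + 1) with hN
  have hev := h.tendsto_g'.eventually_ge_atTop (P.g N - P.g 0)
  obtain ⟨x, hx1, hx2⟩ := (hev.and (eventually_gt_atTop N)).exists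
  have hbN : b ≤ N := le_max_left _ _
  refine ⟨x, hbN.trans hx2.le, ?_⟩
  rw [h.ω3_eq, le_div_iff₀ (h.g'_pos x)]
  have hT : P.tilt (P.g' x) N < P.tilt (P.g' x) x :=
    h.tilt_lt_of_g'_lt hx2 fun s hs =>
      hm (hbN.trans hs.1.le) (hbN.trans hx2.le) hs.2
  have h1 : (C + 1) * P.g' x ≤ N * P.g' x :=
    mul_le_mul_of_nonneg_right (le_max_right _ _) (h.g'_pos x).le
  have h2 : P.tilt (P.g' x) N - P.tilt (P.g' x) 0 = N * P.g' x - (P.g N - P.g 0) := by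
    rw [tilt, tilt]; ring
  linarith

/-- A value above `ω₃ b` is attained on `[b, ∞)` if `g'` increases there. -/
lemma exists_ω3_eq (h : P.Regular) {b β : ℝ} (hm : StrictMonoOn P.g' (Ici b))
    (hβ : P.ω3 b ≤ β) : ∃ x, b ≤ x ∧ P.ω3 x = β := by
  obtain ⟨x, hx, hC⟩ := h.exists_le_ω3 hm β
  obtain ⟨y, hy, hyβ⟩ := intermediate_value_Icc hx h.continuous_ω3.continuousOn ⟨hβ, hC⟩
  exact ⟨y, hy.1, hyβ⟩

/-! ### Case (i): g' increasing -/

/-- The case of an increasing `g'`: the function `φ₀` is invertible. -/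
lemma bijOn_φ0 (h : P.Regular) (hm : StrictMonoOn P.g' (Ici 0)) :
    BijOn P.φ0 (Ici 0) (Ici 0) := by
  have hmono : StrictMonoOn P.φ0 (Ici 0) := h.strictMonoOn_ω3 ordConnected_Ici (fun _ hx => hx) hm
  have h0 : P.φ0 0 = 0 := h.ω3_zero
  refine ⟨fun x hx => ?_, hmono.injOn, fun β hβ => ?_⟩
  · rw [mem_Ici, ← h0]
    exact hmono.monotoneOn self_mem_Ici hx hx
  · exact h.exists_ω3_eq hm (h.ω3_zero.le.trans hβ)

/-- The case of an increasing `g'`: the maximizer of `ζ`. -/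
lemma Mζ_eq_of_strictMonoOn (h : P.Regular) (hm : StrictMonoOn P.g' (Ici 0)) {β : ℝ}
    (hβ : 0 < β) : P.Mζ β = {(0, P.φ0Inv β)} := by
  have hbij := h.bijOn_φ0 hm
  have hmem : P.φ0Inv β ∈ Ici (0 : ℝ) := Function.invFunOn_mem (hbij.surjOn hβ.le)
  have hval : P.ω3 (P.φ0Inv β) = β := Function.invFunOn_eq (hbij.surjOn hβ.le)
  set u := P.φ0Inv β
  have hu : 0 < u := lt_of_le_of_ne hmem fun h0 => by
    rw [← h0, h.ω3_zero] at hval; exact hβ.ne hval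
  have hT := (h.ω3_eq_iff u β).1 hval
  set v := P.g' u with hv
  have hmax : ∀ y, 0 ≤ y → y ≠ u → P.tilt v y < P.tilt v u := by
    intro y hy hne
    rcases lt_or_gt_of_ne hne with hlt | hlt
    · exact h.tilt_lt_of_g'_lt hlt fun s hs => hm (hy.trans hs.1.le) hmem hs.2
    · exact h.tilt_lt_of_lt_g' hlt fun s hs => hm hmem (hu.le.trans hs.1.le) hs.1
  have hmax' : ∀ y, 0 ≤ y → P.tilt v y ≤ P.tilt v u := fun y hy => by
    rcases eq_or_ne y u with rfl | hne
    · rfl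
    · exact (hmax y hy hne).le
  -- For 0 < x < y, quasiconcavity on [0, y] leaves two options: starting at 0 is better, or the
  -- increment over [x, y] is negative.
  have key : ∀ x y, 0 ≤ x → x ≤ y → (x = 0 ∧ y = u) ∨ P.tilt v y - P.tilt v x < β * v := by
    intro x y hx hxy
    rcases eq_or_lt_of_le hx with rfl | hx
    · rcases eq_or_ne y u with rfl | hne
      · exact Or.inl ⟨rfl, rfl⟩
      · right; linarith [hmax y hxy hne]
    · right
      rcases eq_or_lt_of_le hxy with rfl | hxy
      · rw [sub_self]; exact mul_pos hβ (h.g'_pos u)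
      · have h1 := h.min_lt_tilt (v := v) (hm.mono Icc_subset_Ici_self) hx hxy
        have h2 := hmax' y (hx.le.trans hxy.le)
        have h3 := mul_pos hβ (h.g'_pos u)
        rcases min_lt_iff.1 h1 with h1 | h1 <;> linarith
  rw [h.Mζ_eq hβ (h.g'_pos u)
    (fun x y hx hxy => by
      rcases key x y hx hxy with ⟨rfl, rfl⟩ | h1
      · exact hT.le
      · exact h1.le)
    ⟨0, u, le_rfl, hu.le, hT⟩]
  ext ⟨x, y⟩
  simp only [mem_ofPred_eq, mem_singleton_iff, Prod.mk.injEq]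
  constructor
  · rintro ⟨h1, h2, h3⟩
    exact (key x y h1 h2).resolve_right (fun hlt => hlt.ne h3)
  · rintro ⟨rfl, rfl⟩
    exact ⟨le_rfl, hu.le, hT⟩

end Regular

/-! ### Case (ii): the inverse branches of g' -/

namespace ThreePhase

lemma x0_pos (h : P.ThreePhase) : 0 < P.x0 := h.a_pos.trans h.a_lt_x0

lemma g'_x0_lt_g'_a (h : P.ThreePhase) : P.g' P.x0 < P.g' P.a :=
  h.anti_mid (left_mem_Icc.2 h.a_lt_x0.le) (right_mem_Icc.2 h.a_lt_x0.le) h.a_lt_x0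

/-- On `[x₀, ∞)` the tilt at the level `g'(x)` has a strict maximum at `x`. -/
lemma tilt_lt_right (h : P.ThreePhase) {x r : ℝ} (hx : P.x0 ≤ x) (hr : P.x0 ≤ r) (hne : r ≠ x) :
    P.tilt (P.g' x) r < P.tilt (P.g' x) x := by
  rcases lt_or_gt_of_ne hne with hlt | hlt
  · exact h.tilt_lt_of_g'_lt hlt fun s hs => h.mono_right (hr.trans hs.1.le) hx hs.2
  · exact h.tilt_lt_of_lt_g' hlt fun s hs => h.mono_right hx (hx.trans hs.1.le) hs.1

lemma tilt_le_right (h : P.ThreePhase) {x r : ℝ} (hx : P.x0 ≤ x) (hr : P.x0 ≤ r) :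
    P.tilt (P.g' x) r ≤ P.tilt (P.g' x) x := by
  rcases eq_or_ne r x with rfl | hne
  · rfl
  · exact (h.tilt_lt_right hx hr hne).le

lemma exists_right (h : P.ThreePhase) {v : ℝ} (hv : P.g' P.x0 ≤ v) :
    ∃ x, P.x0 ≤ x ∧ P.g' x = v := by
  obtain ⟨b, hb1, hb2⟩ :=
    ((h.tendsto_g'.eventually_ge_atTop v).and (eventually_ge_atTop P.x0)).exists
  obtain ⟨x, hx, rfl⟩ := intermediate_value_Icc hb2 h.continuous_g'.continuousOn ⟨hv, hb1⟩
  exact ⟨x, hx.1, rfl⟩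

/-- Past x₀ the derivative increases to infinity, so it returns to the level g'(a) exactly once, and
the supremum is attained there. -/
lemma a7_spec (h : P.ThreePhase) : P.x0 < P.a7 ∧ P.g' P.a7 = P.g' P.a := by
  obtain ⟨x, hx, hxa⟩ := h.exists_right h.g'_x0_lt_g'_a.le
  have hlt : P.x0 < x := lt_of_le_of_ne hx fun h0 => by
    rw [← h0] at hxa; exact h.g'_x0_lt_g'_a.ne hxa
  have : P.a7 = x := by
    refine IsGreatest.csSup_eq ⟨⟨hlt, hxa.le⟩, fun y hy => ?_⟩
    rw [← hxa] at hy
    exact (h.mono_right.le_iff_le hy.1.le hx).1 hy.2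
  rw [this]
  exact ⟨hlt, hxa⟩

lemma g'_le_g'_a (h : P.ThreePhase) {x : ℝ} (hx : x ∈ Icc P.x0 P.a7) : P.g' x ≤ P.g' P.a := by
  rw [← h.a7_spec.2]
  exact h.mono_right.monotoneOn hx.1 h.a7_spec.1.le hx.2

lemma bijOn_g'_mid (h : P.ThreePhase) :
    BijOn P.g' (Icc P.a P.x0) (Icc (P.g' P.x0) (P.g' P.a7)) := by
  rw [h.a7_spec.2]
  refine ⟨fun x hx => ⟨?_, ?_⟩, h.anti_mid.injOn, ?_⟩
  · exact h.anti_mid.antitoneOn hx (right_mem_Icc.2 h.a_lt_x0.le) hx.2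
  · exact h.anti_mid.antitoneOn (left_mem_Icc.2 h.a_lt_x0.le) hx hx.1
  · exact intermediate_value_Icc' h.a_lt_x0.le h.continuous_g'.continuousOn

/-- The defining property of `(ĝ')₊⁻¹`. -/
lemma gInvPlus_spec (h : P.ThreePhase) {v : ℝ} (hv : v ∈ Icc (P.g' P.x0) (P.g' P.a)) :
    P.gInvPlus v ∈ Icc P.a P.x0 ∧ P.g' (P.gInvPlus v) = v := by
  rw [← h.a7_spec.2] at hv
  have := h.bijOn_g'_mid.surjOn hv
  exact ⟨Function.invFunOn_mem this, Function.invFunOn_eq this⟩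

lemma level_mem (h : P.ThreePhase) {x : ℝ} (hx : x ∈ Icc P.x0 P.a7) :
    P.g' x ∈ Icc (P.g' P.x0) (P.g' P.a) :=
  ⟨h.mono_right.monotoneOn self_mem_Ici hx.1 hx.1, h.g'_le_g'_a hx⟩

/-- On `[a, x₀]` the tilt at the level `v` has its minimum at `(ĝ')₊⁻¹(v)`. -/
lemma tilt_gInvPlus_le (h : P.ThreePhase) {v p : ℝ} (hv : v ∈ Icc (P.g' P.x0) (P.g' P.a))
    (hp : p ∈ Icc P.a P.x0) : P.tilt v (P.gInvPlus v) ≤ P.tilt v p := by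
  obtain ⟨hm, he⟩ := h.gInvPlus_spec hv
  rcases lt_trichotomy p (P.gInvPlus v) with hlt | heq | hlt
  · refine (h.tilt_lt_of_lt_g' hlt fun s hs => ?_).le
    have := h.anti_mid ⟨hp.1.trans hs.1.le, hs.2.le.trans hm.2⟩ hm hs.2
    rwa [he] at this
  · rw [heq]
  · refine (h.tilt_lt_of_g'_lt hlt fun s hs => ?_).le
    have := h.anti_mid hm ⟨hm.1.trans hs.1.le, hs.2.le.trans hp.2⟩ hs.1
    rwa [he] at this

/-- The defining property of `(ĝ')₋⁻¹`. -/
lemma gInvMinus_spec (h : P.ThreePhase) {v : ℝ} (hv : v ≤ P.g' P.a) :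
    P.gInvMinus v ∈ Icc 0 P.a ∧ v ≤ P.g' (P.gInvMinus v) ∧
      ∀ y ∈ Icc 0 P.a, y < P.gInvMinus v → P.g' y < v := by
  have hbdd : BddBelow {y | y ∈ Icc 0 P.a ∧ v ≤ P.g' y} := ⟨0, fun y hy => hy.1.1⟩
  have hmem : P.gInvMinus v ∈ {y | y ∈ Icc 0 P.a ∧ v ≤ P.g' y} :=
    IsClosed.csInf_mem (isClosed_Icc.inter (isClosed_le continuous_const h.continuous_g'))
      ⟨P.a, right_mem_Icc.2 h.a_pos.le, hv⟩ hbdd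
  refine ⟨hmem.1, hmem.2, fun y hy hlt => not_le.1 fun hn => ?_⟩
  exact hlt.not_ge (csInf_le hbdd ⟨hy, hn⟩)

/-- Positivity is needed: if the level lies below g'(0), the infimum is 0 and the level is not
attained there. Otherwise the inequality g' < v on the left passes to the limit. -/
lemma g'_gInvMinus (h : P.ThreePhase) {v : ℝ} (hv : v ≤ P.g' P.a) (hpos : 0 < P.gInvMinus v) :
    P.g' (P.gInvMinus v) = v := by
  obtain ⟨hm, hge, hlt⟩ := h.gInvMinus_spec hv
  refine le_antisymm ?_ hge
  refine le_of_tendsto (h.continuous_g'.continuousAt.tendsto.mono_left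
    (nhdsWithin_le_nhds (s := Iio (P.gInvMinus v)))) ?_
  filter_upwards [Ioo_mem_nhdsLT hpos] with y hy
  exact (hlt y ⟨hy.1.le, hy.2.le.trans hm.2⟩ hy.2).le

/-- On `[0, a]` the tilt at the level `v` has its maximum at `(ĝ')₋⁻¹(v)`. -/
lemma tilt_le_gInvMinus (h : P.ThreePhase) {v y : ℝ} (hv : v ≤ P.g' P.a)
    (hy : y ∈ Icc 0 P.a) : P.tilt v y ≤ P.tilt v (P.gInvMinus v) := by
  obtain ⟨hm, hge, hlt⟩ := h.gInvMinus_spec hv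
  rcases lt_trichotomy y (P.gInvMinus v) with hc | heq | hc
  · exact (h.tilt_lt_of_g'_lt hc fun s hs =>
      hlt s ⟨hy.1.trans hs.1.le, hs.2.le.trans hm.2⟩ hs.2).le
  · rw [heq]
  · exact (h.tilt_lt_of_lt_g' hc fun s hs => hge.trans_lt
      (h.mono_left hm ⟨hm.1.trans hs.1.le, hs.2.le.trans hy.2⟩ hs.1)).le

/-! ### The points `x₃` and `x₄` -/

/-- The set whose infimum is `x₃`, described through the tilt. -/
lemma x3_set_eq (h : P.ThreePhase) :
    {x | x ∈ Icc P.x0 P.a7 ∧ 0 ≤ ∫ s in (0 : ℝ)..P.gInvPlus (P.g' x), (1 - P.g' s / P.g' x)} =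
    Icc P.x0 P.a7 ∩ ⋂ p ∈ Icc P.a P.x0, {x | P.tilt (P.g' x) 0 ≤ P.tilt (P.g' x) p} := by
  ext x
  simp only [mem_ofPred_eq, mem_inter_iff, mem_iInter₂, and_congr_right_iff]
  intro hx
  rw [h.integral_one_sub (h.g'_pos x), le_div_iff₀ (h.g'_pos x), zero_mul, sub_nonneg]
  exact ⟨fun h1 p hp => h1.trans (h.tilt_gInvPlus_le (h.level_mem hx) hp),
    fun h1 => h1 _ (h.gInvPlus_spec (h.level_mem hx)).1⟩

/-- The set whose infimum is `x₄`, described through the tilt. -/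
lemma x4_set_eq (h : P.ThreePhase) :
    {x | x ∈ Icc P.x0 P.a7 ∧ 0 ≤ ∫ s in P.gInvMinus (P.g' x)..x, (1 - P.g' s / P.g' x)} =
    Icc P.x0 P.a7 ∩ ⋂ y ∈ Icc 0 P.a, {x | P.tilt (P.g' x) y ≤ P.tilt (P.g' x) x} := by
  ext x
  simp only [mem_ofPred_eq, mem_inter_iff, mem_iInter₂, and_congr_right_iff]
  intro hx
  rw [h.integral_one_sub (h.g'_pos x), le_div_iff₀ (h.g'_pos x), zero_mul, sub_nonneg]
  exact ⟨fun h1 p hp => (h.tilt_le_gInvMinus (h.g'_le_g'_a hx) hp).trans h1,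
    fun h1 => h1 _ (h.gInvMinus_spec (h.g'_le_g'_a hx)).1⟩

lemma continuous_tilt_level (h : P.ThreePhase) {f : ℝ → ℝ} (hf : Continuous f) :
    Continuous fun x => P.tilt (P.g' x) (f x) := by
  have h1 := h.continuous_g'
  have h2 := h.continuous_g
  unfold tilt
  fun_prop

/-- The infimum is attained because the set is closed, which is visible once the inverse function is
replaced by a condition on all p. The set contains a₇: at the level g'(a), the tilt increases on all
of [0, x₀]. -/
lemma x3_mem (h : P.ThreePhase) :
    P.x3 ∈ Icc P.x0 P.a7 ∩ ⋂ p ∈ Icc P.a P.x0, {x | P.tilt (P.g' x) 0 ≤ P.tilt (P.g' x) p} := by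
  have hc : IsClosed (Icc P.x0 P.a7 ∩
      ⋂ p ∈ Icc P.a P.x0, {x | P.tilt (P.g' x) 0 ≤ P.tilt (P.g' x) p}) :=
    isClosed_Icc.inter (isClosed_biInter fun p _ => isClosed_le
      (h.continuous_tilt_level continuous_const) (h.continuous_tilt_level continuous_const))
  rw [x3, h.x3_set_eq]
  refine hc.csInf_mem ⟨P.a7, right_mem_Icc.2 h.a7_spec.1.le, ?_⟩ ⟨P.x0, fun x hx => hx.1.1⟩
  simp only [mem_iInter₂, mem_ofPred_eq]
  intro p hp
  rw [h.a7_spec.2]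
  refine le_trans (h.tilt_lt_of_g'_lt h.a_pos fun s hs => ?_).le ?_ (b := P.tilt (P.g' P.a) P.a)
  · exact h.mono_left ⟨hs.1.le, hs.2.le⟩ (right_mem_Icc.2 h.a_pos.le) hs.2
  · rcases eq_or_lt_of_le hp.1 with h1 | h1
    · rw [h1]
    · exact (h.tilt_lt_of_g'_lt h1 fun s hs => h.anti_mid (left_mem_Icc.2 h.a_lt_x0.le)
        ⟨hs.1.le, hs.2.le.trans hp.2⟩ hs.1).le

lemma x3_le (h : P.ThreePhase) {x : ℝ} (hx : x ∈ Icc P.x0 P.a7)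
    (hT : ∀ p ∈ Icc P.a P.x0, P.tilt (P.g' x) 0 ≤ P.tilt (P.g' x) p) : P.x3 ≤ x := by
  rw [x3, h.x3_set_eq]
  exact csInf_le ⟨P.x0, fun x hx => hx.1.1⟩ ⟨hx, mem_iInter₂.2 hT⟩

lemma x0_le_x3 (h : P.ThreePhase) : P.x0 ≤ P.x3 := h.x3_mem.1.1

/-- From `x₃` on, starting at `0` is at least as good as starting in `[a, x₀]`. -/
lemma tilt_zero_le (h : P.ThreePhase) {x p : ℝ} (hx : P.x3 ≤ x) (hp : p ∈ Icc P.a P.x0) :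
    P.tilt (P.g' x) 0 ≤ P.tilt (P.g' x) p := by
  have h1 : P.tilt (P.g' P.x3) 0 ≤ P.tilt (P.g' P.x3) p := mem_iInter₂.1 h.x3_mem.2 p hp
  have h2 := h.mono_right.monotoneOn h.x0_le_x3 (h.x0_le_x3.trans hx) hx
  rw [tilt_zero _ (P.g' P.x3), tilt_sub_tilt (P.g' x) (P.g' P.x3) p]
  have := mul_nonneg (sub_nonneg.2 h2) (h.a_pos.le.trans hp.1)
  linarith

lemma tilt_zero_lt (h : P.ThreePhase) {x p : ℝ} (hx : P.x3 < x) (hp : p ∈ Icc P.a P.x0) :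
    P.tilt (P.g' x) 0 < P.tilt (P.g' x) p := by
  have h1 := h.tilt_zero_le le_rfl hp
  have h2 := h.mono_right h.x0_le_x3 (h.x0_le_x3.trans hx.le) hx
  rw [tilt_zero _ (P.g' P.x3), tilt_sub_tilt (P.g' x) (P.g' P.x3) p]
  have := mul_pos (sub_pos.2 h2) (h.a_pos.trans_le hp.1)
  linarith

/-- If `x₃ > x₀`, the two ways of starting are equally good at the level `g'(x₃)`. -/
lemma tilt_gInvPlus_x3 (h : P.ThreePhase) (hlt : P.x0 < P.x3) :
    P.tilt (P.g' P.x3) (P.gInvPlus (P.g' P.x3)) = P.tilt (P.g' P.x3) 0 := by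
  have hx3 := h.x3_mem.1
  refine le_antisymm (not_lt.1 fun hcon => ?_)
    (h.tilt_zero_le le_rfl (h.gInvPlus_spec (h.level_mem hx3)).1)
  -- If the inequality at x₃ were strict, a slightly lower level would still do: the tilt at p falls
  -- by at most (g'(x₃) - g'(x)) x₀, uniformly in p ≤ x₀. This contradicts the minimality of x₃.
  have hc : Continuous fun x => (P.g' P.x3 - P.g' x) * P.x0 := by
    have := h.continuous_g'
    fun_prop
  have hev : ∀ᶠ x in 𝓝[<] P.x3, (P.g' P.x3 - P.g' x) * P.x0 <
      P.tilt (P.g' P.x3) (P.gInvPlus (P.g' P.x3)) - P.tilt (P.g' P.x3) 0 := by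
    refine (hc.continuousAt.tendsto.mono_left nhdsWithin_le_nhds).eventually_lt_const ?_
    simpa using hcon
  obtain ⟨x, hx, hx0⟩ := (hev.and (Ioo_mem_nhdsLT hlt)).exists
  refine hx0.2.not_ge (h.x3_le ⟨hx0.1.le, hx0.2.le.trans hx3.2⟩ fun p hp => ?_)
  have h1 := h.tilt_gInvPlus_le (h.level_mem hx3) hp
  have h2 : (P.g' P.x3 - P.g' x) * p ≤ (P.g' P.x3 - P.g' x) * P.x0 :=
    mul_le_mul_of_nonneg_left hp.2 (sub_nonneg.2
      (h.mono_right.monotoneOn hx0.1.le h.x0_le_x3 hx0.2.le))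
  rw [tilt_zero _ (P.g' P.x3)]
  have h3 := tilt_sub_tilt (P := P) (P.g' P.x3) (P.g' x) p
  linarith

lemma x4_mem (h : P.ThreePhase) :
    P.x4 ∈ Icc P.x0 P.a7 ∩ ⋂ y ∈ Icc 0 P.a, {x | P.tilt (P.g' x) y ≤ P.tilt (P.g' x) x} := by
  have hc : IsClosed (Icc P.x0 P.a7 ∩
      ⋂ y ∈ Icc 0 P.a, {x | P.tilt (P.g' x) y ≤ P.tilt (P.g' x) x}) :=
    isClosed_Icc.inter (isClosed_biInter fun p _ => isClosed_le
      (h.continuous_tilt_level continuous_const) (h.continuous_tilt_level continuous_id))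
  rw [x4, h.x4_set_eq]
  refine hc.csInf_mem ⟨P.a7, right_mem_Icc.2 h.a7_spec.1.le, ?_⟩ ⟨P.x0, fun x hx => hx.1.1⟩
  simp only [mem_iInter₂, mem_ofPred_eq]
  intro y hy
  have h1 : P.tilt (P.g' P.a7) P.x0 ≤ P.tilt (P.g' P.a7) P.a7 :=
    h.tilt_le_right h.a7_spec.1.le le_rfl
  refine le_trans ?_ h1
  rw [h.a7_spec.2]
  refine le_trans ?_ (h.tilt_lt_of_g'_lt h.a_lt_x0 fun s hs => h.anti_mid
    (left_mem_Icc.2 h.a_lt_x0.le) ⟨hs.1.le, hs.2.le⟩ hs.1).le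
  rcases eq_or_lt_of_le hy.2 with h2 | h2
  · rw [h2]
  · exact (h.tilt_lt_of_g'_lt h2 fun s hs => h.mono_left ⟨hy.1.trans hs.1.le, hs.2.le⟩
      (right_mem_Icc.2 h.a_pos.le) hs.2).le

lemma x4_le (h : P.ThreePhase) {x : ℝ} (hx : x ∈ Icc P.x0 P.a7)
    (hT : ∀ y ∈ Icc 0 P.a, P.tilt (P.g' x) y ≤ P.tilt (P.g' x) x) : P.x4 ≤ x := by
  rw [x4, h.x4_set_eq]
  exact csInf_le ⟨P.x0, fun x hx => hx.1.1⟩ ⟨hx, mem_iInter₂.2 hT⟩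

/-- At its own level x₀ is a worse end point than a. This forces x₄ > x₀ and later excludes x₃ = x₀
when the two levels tie. -/
lemma tilt_x0_lt_a (h : P.ThreePhase) :
    P.tilt (P.g' P.x0) P.x0 < P.tilt (P.g' P.x0) P.a :=
  h.tilt_lt_of_lt_g' h.a_lt_x0 fun _ hs =>
    h.anti_mid ⟨hs.1.le, hs.2.le⟩ (right_mem_Icc.2 h.a_lt_x0.le) hs.2

/-- From `x₄` on, stopping late is at least as good as stopping in `[0, a]`. -/
lemma tilt_left_lt (h : P.ThreePhase) {x y : ℝ} (hx : P.x4 < x) (hy : y ∈ Icc 0 P.a) :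
    P.tilt (P.g' x) y < P.tilt (P.g' x) x := by
  have h4 := h.x4_mem
  have h1 : P.tilt (P.g' P.x4) y ≤ P.tilt (P.g' P.x4) P.x4 := mem_iInter₂.1 h4.2 y hy
  have h2 := h.mono_right h4.1.1 (h4.1.1.trans hx.le) hx
  have h3 : P.tilt (P.g' x) P.x4 ≤ P.tilt (P.g' x) x :=
    h.tilt_le_right (h4.1.1.trans hx.le) h4.1.1
  refine lt_of_lt_of_le ?_ h3
  rw [tilt_sub_tilt (P.g' x) (P.g' P.x4) y, tilt_sub_tilt (P.g' x) (P.g' P.x4) P.x4]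
  have := mul_lt_mul_of_pos_left ((hy.2.trans_lt h.a_lt_x0).trans_le h4.1.1) (sub_pos.2 h2)
  linarith

lemma tilt_left_le (h : P.ThreePhase) {x y : ℝ} (hx : P.x4 ≤ x) (hy : y ∈ Icc 0 P.a) :
    P.tilt (P.g' x) y ≤ P.tilt (P.g' x) x := by
  rcases eq_or_lt_of_le hx with rfl | hx
  · exact mem_iInter₂.1 h.x4_mem.2 y hy
  · exact (h.tilt_left_lt hx hy).le

lemma x0_lt_x4 (h : P.ThreePhase) : P.x0 < P.x4 := by
  refine lt_of_le_of_ne h.x4_mem.1.1 fun he => ?_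
  have := h.tilt_left_le le_rfl (right_mem_Icc.2 h.a_pos.le)
  rw [← he] at this
  exact this.not_gt h.tilt_x0_lt_a

/-- At the level `g'(x₄)` the two ways of stopping are equally good. -/
lemma tilt_gInvMinus_x4 (h : P.ThreePhase) :
    P.tilt (P.g' P.x4) (P.gInvMinus (P.g' P.x4)) = P.tilt (P.g' P.x4) P.x4 := by
  have hx4 := h.x4_mem.1
  refine le_antisymm (h.tilt_left_le le_rfl (h.gInvMinus_spec (h.g'_le_g'_a hx4)).1)
    (not_lt.1 fun hcon => ?_)
  -- If stopping at x₄ were strictly better, some x < x₄ would also qualify: lowering the level does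
  -- not raise the tilt at y ≥ 0, and the tilt at x varies continuously.
  have hev : ∀ᶠ x in 𝓝[<] P.x4,
      P.tilt (P.g' P.x4) (P.gInvMinus (P.g' P.x4)) < P.tilt (P.g' x) x :=
    ((h.continuous_tilt_level continuous_id).continuousAt.tendsto.mono_left
      nhdsWithin_le_nhds).eventually_const_lt hcon
  obtain ⟨x, hx, hx0⟩ := (hev.and (Ioo_mem_nhdsLT h.x0_lt_x4)).exists
  refine hx0.2.not_ge (h.x4_le ⟨hx0.1.le, hx0.2.le.trans hx4.2⟩ fun y hy => ?_)
  have h1 := h.tilt_le_gInvMinus (h.g'_le_g'_a hx4) hy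
  have h2 : 0 ≤ (P.g' P.x4 - P.g' x) * y := mul_nonneg (sub_nonneg.2
      (h.mono_right.monotoneOn hx0.1.le hx4.1 hx0.2.le)) hy.1
  have h3 := tilt_sub_tilt (P := P) (P.g' P.x4) (P.g' x) y
  linarith

/-! ### The function `ω₃` -/

lemma strictMonoOn_ω3_left (h : P.ThreePhase) : StrictMonoOn P.ω3 (Icc 0 P.a) :=
  h.strictMonoOn_ω3 ordConnected_Icc (fun _ hx => hx.1) h.mono_left

lemma strictMonoOn_ω3_right (h : P.ThreePhase) : StrictMonoOn P.ω3 (Ici P.x0) :=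
  h.strictMonoOn_ω3 ordConnected_Ici (fun _ hx => h.x0_pos.le.trans hx) h.mono_right

/-- The end points of the two parts of the domain of `ω₃` have the same image. -/
lemma ω3_gInvMinus (h : P.ThreePhase) : P.ω3 (P.gInvMinus (P.g' P.x4)) = P.ω3 P.x4 := by
  have hle := h.g'_le_g'_a h.x4_mem.1
  have hT := h.tilt_gInvMinus_x4
  -- If the left end point is 0, its level need not be g'(x₄), but then both values of ω₃ vanish.
  rcases eq_or_lt_of_le (h.gInvMinus_spec hle).1.1 with h0 | h0
  · rw [← h0] at hT ⊢
    rw [h.ω3_zero, h.ω3_eq, ← hT, sub_self, zero_div]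
  · rw [h.ω3_eq, h.ω3_eq, h.g'_gInvMinus hle h0, hT]

/-- ω₃ increases on each part of its domain, and the images [0, ω₃(x₄)] and [ω₃(x₄), ∞) meet only at
their common end, so other values are taken once. -/
lemma ω3Inv_of_lt (h : P.ThreePhase) {β : ℝ} (hβ : 0 < β) (hlt : β < P.ω3 P.x4) :
    ∃ u, P.ω3Inv β = {u} := by
  have hm := (h.gInvMinus_spec (h.g'_le_g'_a h.x4_mem.1)).1
  have hmono := h.strictMonoOn_ω3_left.mono (Icc_subset_Icc_right hm.2)
  obtain ⟨u, hu, hue⟩ := intermediate_value_Icc hm.1 h.continuous_ω3.continuousOn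
    (show β ∈ Icc (P.ω3 0) (P.ω3 (P.gInvMinus (P.g' P.x4))) by
      rw [h.ω3_zero, h.ω3_gInvMinus]; exact ⟨hβ.le, hlt.le⟩)
  refine ⟨u, eq_singleton_iff_unique_mem.2 ⟨⟨Or.inl hu, hue⟩, ?_⟩⟩
  rintro y ⟨hy | hy, hye⟩
  · exact hmono.injOn hy hu (hye.trans hue.symm)
  · have := h.strictMonoOn_ω3_right.monotoneOn h.x0_lt_x4.le (h.x0_lt_x4.le.trans hy) hy
    linarith

lemma ω3Inv_of_gt (h : P.ThreePhase) {β : ℝ} (hlt : P.ω3 P.x4 < β) :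
    ∃ u, P.ω3Inv β = {u} := by
  have hm := (h.gInvMinus_spec (h.g'_le_g'_a h.x4_mem.1)).1
  have hmono := h.strictMonoOn_ω3_left.mono (Icc_subset_Icc_right hm.2)
  obtain ⟨u, hu, hue⟩ := h.exists_ω3_eq
    (h.mono_right.mono (Ici_subset_Ici.2 h.x0_lt_x4.le)) hlt.le
  refine ⟨u, eq_singleton_iff_unique_mem.2 ⟨⟨Or.inr hu, hue⟩, ?_⟩⟩
  rintro y ⟨hy | hy, hye⟩
  · have := hmono.monotoneOn hy (right_mem_Icc.2 hm.1) hy.2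
    rw [h.ω3_gInvMinus] at this
    linarith
  · exact h.strictMonoOn_ω3_right.injOn (h.x0_lt_x4.le.trans hy) (h.x0_lt_x4.le.trans hu)
      (hye.trans hue.symm)

lemma ω3Inv_of_eq (h : P.ThreePhase) (hβ : 0 < P.ω3 P.x4) :
    P.ω3Inv (P.ω3 P.x4) = {P.gInvMinus (P.g' P.x4), P.x4} ∧
      P.g' (P.gInvMinus (P.g' P.x4)) = P.g' P.x4 := by
  have hm := (h.gInvMinus_spec (h.g'_le_g'_a h.x4_mem.1)).1
  have hmono := h.strictMonoOn_ω3_left.mono (Icc_subset_Icc_right hm.2)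
  constructor
  · ext y
    constructor
    · rintro ⟨hy | hy, hye⟩
      · exact Or.inl (hmono.injOn hy (right_mem_Icc.2 hm.1) (hye.trans h.ω3_gInvMinus.symm))
      · exact Or.inr (h.strictMonoOn_ω3_right.injOn (h.x0_lt_x4.le.trans hy) h.x0_lt_x4.le hye)
    · rintro (rfl | rfl)
      · exact ⟨Or.inl (right_mem_Icc.2 hm.1), h.ω3_gInvMinus⟩
      · exact ⟨Or.inr self_mem_Ici, rfl⟩
  · refine h.g'_gInvMinus (h.g'_le_g'_a h.x4_mem.1) (lt_of_le_of_ne hm.1 fun h0 => ?_)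
    rw [← h.ω3_gInvMinus, ← h0, h.ω3_zero] at hβ
    exact hβ.false

lemma ω3Inv_singleton (h : P.ThreePhase) {β : ℝ} (hβ : 0 < β) (hne : β ≠ P.ω3 P.x4) :
    ∃ u, P.ω3Inv β = {u} := by
  rcases lt_or_gt_of_ne hne with hlt | hlt
  · exact h.ω3Inv_of_lt hβ hlt
  · exact h.ω3Inv_of_gt hlt

lemma ω3Inv_nonempty (h : P.ThreePhase) {β : ℝ} (hβ : 0 < β) : (P.ω3Inv β).Nonempty := by
  rcases eq_or_ne β (P.ω3 P.x4) with rfl | hne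
  · rw [(h.ω3Inv_of_eq hβ).1]; exact insert_nonempty _ _
  · obtain ⟨u, hu⟩ := h.ω3Inv_singleton hβ hne
    rw [hu]; exact singleton_nonempty u

/-- `g'` is constant on `ω₃⁻¹(β)`. -/
lemma g'_eq_of_mem_ω3Inv (h : P.ThreePhase) {β u w : ℝ} (hβ : 0 < β) (hu : u ∈ P.ω3Inv β)
    (hw : w ∈ P.ω3Inv β) : P.g' u = P.g' w := by
  rcases eq_or_ne β (P.ω3 P.x4) with rfl | hne
  · obtain ⟨h1, h2⟩ := h.ω3Inv_of_eq hβ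
    rw [h1] at hu hw
    rcases hu with rfl | rfl <;> rcases hw with rfl | rfl <;> simp [h2]
  · obtain ⟨y, hy⟩ := h.ω3Inv_singleton hβ hne
    rw [hy] at hu hw
    rw [mem_singleton_iff.1 hu, mem_singleton_iff.1 hw]

lemma pos_of_mem_ω3Inv (h : P.ThreePhase) {β u : ℝ} (hβ : 0 < β) (hu : u ∈ P.ω3Inv β) :
    0 < u := by
  rcases hu with ⟨hu | hu, hue⟩
  · refine lt_of_le_of_ne hu.1 fun h0 => ?_
    rw [← h0, h.ω3_zero] at hue
    exact hβ.ne hue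
  · exact h.x0_pos.trans (h.x0_lt_x4.trans_le hu)

/-- A point of `ω₃⁻¹(β)` maximizes the tilt over `[0, a] ∪ [x₀, ∞)` at its own level. -/
lemma tilt_le_of_mem_ω3Inv (h : P.ThreePhase) {β u y : ℝ} (hβ : 0 < β) (hu : u ∈ P.ω3Inv β)
    (hy : y ∈ Icc 0 P.a ∪ Ici P.x0) : P.tilt (P.g' u) y ≤ P.tilt (P.g' u) u := by
  have hpos := h.pos_of_mem_ω3Inv hβ hu
  have hm := (h.gInvMinus_spec (h.g'_le_g'_a h.x4_mem.1)).1
  rcases hu with ⟨hu | hu, -⟩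
  · have hua : u ∈ Icc 0 P.a := ⟨hu.1, hu.2.trans hm.2⟩
    rcases hy with hy | hy
    · rcases lt_trichotomy y u with hc | rfl | hc
      · exact (h.tilt_lt_of_g'_lt hc fun s hs =>
          h.mono_left ⟨hy.1.trans hs.1.le, hs.2.le.trans hua.2⟩ hua hs.2).le
      · rfl
      · exact (h.tilt_lt_of_lt_g' hc fun s hs =>
          h.mono_left hua ⟨hua.1.trans hs.1.le, hs.2.le.trans hy.2⟩ hs.1).le
    -- A point y on the far right loses to the left end point at the level g'(x₄) already, and
    -- lowering the level to g'(u) only favours the left one.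
    · have h4 := h.g'_gInvMinus (h.g'_le_g'_a h.x4_mem.1) (hpos.trans_le hu.2)
      have hlev : P.g' u ≤ P.g' P.x4 := by
        rw [← h4]; exact h.mono_left.monotoneOn hua hm hu.2
      have h1 : P.tilt (P.g' P.x4) y ≤ P.tilt (P.g' P.x4) (P.gInvMinus (P.g' P.x4)) :=
        (h.tilt_le_right h.x0_lt_x4.le hy).trans h.tilt_gInvMinus_x4.ge
      have h2 : P.tilt (P.g' u) y ≤ P.tilt (P.g' u) (P.gInvMinus (P.g' P.x4)) := by
        rw [tilt_sub_tilt (P.g' P.x4) (P.g' u) y,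
          tilt_sub_tilt (P.g' P.x4) (P.g' u) (P.gInvMinus (P.g' P.x4))] at h1
        have := mul_le_mul_of_nonneg_left ((hm.2.trans h.a_lt_x0.le).trans hy)
          (sub_nonneg.2 hlev)
        linarith
      refine h2.trans ?_
      rcases eq_or_lt_of_le hu.2 with he | hc
      · rw [← he]
      · exact (h.tilt_lt_of_lt_g' hc fun s hs =>
          h.mono_left hua ⟨hua.1.trans hs.1.le, hs.2.le.trans hm.2⟩ hs.1).le
  · rcases hy with hy | hy
    · exact h.tilt_left_le hu hy
    · exact h.tilt_le_right (h.x0_lt_x4.le.trans hu) hy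

/-- A maximizer of the tilt over `[0, a] ∪ [x₀, ∞)` belongs to the domain of `ω₃`. -/
lemma mem_ω3Dom (h : P.ThreePhase) {y : ℝ} (hy : y ∈ Icc 0 P.a ∪ Ici P.x0)
    (hmax : ∀ y' ∈ Icc 0 P.a ∪ Ici P.x0, P.tilt (P.g' y) y' ≤ P.tilt (P.g' y) y) :
    y ∈ P.ω3Dom := by
  have hle := h.g'_le_g'_a h.x4_mem.1
  have hm := h.gInvMinus_spec hle
  rcases hy with hy | hy
  · refine Or.inl ⟨hy.1, not_lt.1 fun hlt => ?_⟩
    -- A maximizer y beyond the left part would have a level above g'(x₄), and the point of [x₀, ∞)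
    -- with the same level would beat it.
    have hg : P.g' P.x4 < P.g' y := hm.2.1.trans_lt (h.mono_left hm.1 hy hlt)
    obtain ⟨x, hx, hxe⟩ := h.exists_right
      ((h.mono_right self_mem_Ici h.x0_lt_x4.le h.x0_lt_x4).le.trans hg.le)
    have hx4 : P.x4 < x := by
      rw [← hxe] at hg
      exact (h.mono_right.lt_iff_lt h.x0_lt_x4.le hx).1 hg
    have h1 := h.tilt_left_lt hx4 hy
    rw [hxe] at h1
    exact h1.not_ge (hmax x (Or.inr hx))
  · refine Or.inr (mem_Ici.2 (not_lt.1 fun hlt => ?_))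
    exact hlt.not_ge (h.x4_le ⟨hy, (le_of_lt hlt).trans h.x4_mem.1.2⟩
      fun y' hy' => hmax y' (Or.inl hy'))

/-! ### The function `ω₄` -/

/-- The minimum of the tilt over `[a, x₀]` depends continuously on the level. -/
lemma continuousOn_tilt_gInvPlus (h : P.ThreePhase) :
    ContinuousOn (fun v => P.tilt v (P.gInvPlus v)) (Icc (P.g' P.x0) (P.g' P.a)) := by
  -- The function is a minimum of affine functions of v with slopes in [a, x₀], hence Lipschitz with
  -- constant x₀.
  have key : ∀ v ∈ Icc (P.g' P.x0) (P.g' P.a), ∀ w ∈ Icc (P.g' P.x0) (P.g' P.a),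
      P.tilt v (P.gInvPlus v) - P.tilt w (P.gInvPlus w) ≤ P.x0 * |v - w| := by
    intro v hv w hw
    have hp := (h.gInvPlus_spec hw).1
    have h1 := h.tilt_gInvPlus_le hv hp
    rw [tilt_sub_tilt v w (P.gInvPlus w)] at h1
    have h2 : (v - w) * P.gInvPlus w ≤ |v - w| * P.x0 :=
      mul_le_mul (le_abs_self _) hp.2 (h.a_pos.le.trans hp.1) (abs_nonneg _)
    linarith
  refine (LipschitzOnWith.of_dist_le_mul (K := P.x0.toNNReal)
    fun v hv w hw => ?_).continuousOn
  rw [Real.dist_eq, Real.dist_eq, Real.coe_toNNReal _ h.x0_pos.le, abs_le]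
  have h1 := key v hv w hw
  have h2 := key w hw v hv
  rw [abs_sub_comm] at h2
  exact ⟨by linarith, h1⟩

lemma ω4_of_lt (h : P.ThreePhase) {x : ℝ} (hx : x < P.x3) :
    P.ω4 x = (P.tilt (P.g' x) x - P.tilt (P.g' x) (P.gInvPlus (P.g' x))) / P.g' x := by
  rw [ω4, if_pos hx, h.integral_one_sub (h.g'_pos x)]

lemma ω4_of_ge {x : ℝ} (hx : P.x3 ≤ x) : P.ω4 x = P.ω3 x := by
  rw [ω4, if_neg (not_lt.2 hx), ω3]

/-- The first formula for `ω₄` extends to the end point `x₃` unless `x₃ = x₀`. -/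
lemma ω4_of_le (h : P.ThreePhase) (h3 : P.x0 < P.x3) {x : ℝ} (hx : x ≤ P.x3) :
    P.ω4 x = (P.tilt (P.g' x) x - P.tilt (P.g' x) (P.gInvPlus (P.g' x))) / P.g' x := by
  rcases eq_or_lt_of_le hx with rfl | hx
  · rw [ω4_of_ge le_rfl, h.ω3_eq, h.tilt_gInvPlus_x3 h3]
  · exact h.ω4_of_lt hx

lemma level_mem_of_le_x3 (h : P.ThreePhase) {x : ℝ} (hx : x ∈ Icc P.x0 P.x3) :
    P.g' x ∈ Icc (P.g' P.x0) (P.g' P.a) :=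
  h.level_mem ⟨hx.1, hx.2.trans h.x3_mem.1.2⟩

lemma continuousOn_ω4_left (h : P.ThreePhase) : ContinuousOn P.ω4 (Icc P.x0 P.x3) := by
  rcases eq_or_lt_of_le h.x0_le_x3 with h3 | h3
  · rw [← h3, Icc_self]; exact continuousOn_singleton _ _
  · refine ContinuousOn.congr (f := fun x =>
      (P.tilt (P.g' x) x - P.tilt (P.g' x) (P.gInvPlus (P.g' x))) / P.g' x) ?_
      fun x hx => h.ω4_of_le h3 hx.2
    refine ContinuousOn.div ?_ h.continuous_g'.continuousOn fun x _ => (h.g'_pos x).ne'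
    refine (h.continuous_tilt_level continuous_id).continuousOn.sub ?_
    exact h.continuousOn_tilt_gInvPlus.comp h.continuous_g'.continuousOn
      fun x hx => h.level_mem_of_le_x3 hx

/-- As for ω₃, move the end point and then the level, keeping the optimal start p of the lower level
as a competitor at the higher one. -/
lemma strictMonoOn_ω4_left (h : P.ThreePhase) : StrictMonoOn P.ω4 (Icc P.x0 P.x3) := by
  intro x hx y hy hxy
  have h3 : P.x0 < P.x3 := hx.1.trans_lt (hxy.trans_le hy.2)
  rw [h.ω4_of_le h3 hx.2, h.ω4_of_le h3 hy.2]
  have hg : P.g' x < P.g' y := h.mono_right hx.1 hy.1 hxy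
  have hp := (h.gInvPlus_spec (h.level_mem_of_le_x3 hx)).1
  set p := P.gInvPlus (P.g' x)
  have h1 : P.tilt (P.g' y) x < P.tilt (P.g' y) y := h.tilt_lt_right hy.1 hx.1 hxy.ne
  have h2 := h.tilt_gInvPlus_le (h.level_mem_of_le_x3 hy) hp
  refine lt_of_le_of_lt (b := (P.tilt (P.g' y) x - P.tilt (P.g' y) p) / P.g' y) ?_
    (div_lt_div_of_pos_right (by linarith) (h.g'_pos y))
  -- Equality p = x occurs only when both are x₀; the interval is then degenerate.
  rcases eq_or_lt_of_le (hp.2.trans hx.1) with he | hc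
  · rw [he]; simp
  · exact (h.tilt_div_lt (h.g'_pos x) hg hc).le

lemma strictMonoOn_ω4 (h : P.ThreePhase) : StrictMonoOn P.ω4 (Ici P.x0) := by
  rw [← Icc_union_Ici_eq_Ici h.x0_le_x3]
  refine h.strictMonoOn_ω4_left.union ?_ (isGreatest_Icc h.x0_le_x3) isLeast_Ici
  exact (h.strictMonoOn_ω3_right.mono (Ici_subset_Ici.2 h.x0_le_x3)).congr
    fun x hx => (ω4_of_ge hx).symm

lemma bijOn_ω4 (h : P.ThreePhase) : BijOn P.ω4 (Ici P.x0) (Ici (P.ω4 P.x0)) := by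
  refine ⟨fun x hx => h.strictMonoOn_ω4.monotoneOn self_mem_Ici hx hx, h.strictMonoOn_ω4.injOn,
    fun β hβ => ?_⟩
  rcases le_total β (P.ω4 P.x3) with hc | hc
  · obtain ⟨x, hx, hxe⟩ := intermediate_value_Icc h.x0_le_x3 h.continuousOn_ω4_left ⟨hβ, hc⟩
    exact ⟨x, hx.1, hxe⟩
  · rw [ω4_of_ge le_rfl] at hc
    obtain ⟨x, hx, hxe⟩ := h.exists_ω3_eq
      (h.mono_right.mono (Ici_subset_Ici.2 h.x0_le_x3)) hc
    exact ⟨x, h.x0_le_x3.trans hx, (ω4_of_ge hx).trans hxe⟩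

lemma ω4Inv_spec {β : ℝ} (hβ : β ∈ P.ω4 '' Ici P.x0) :
    P.x0 ≤ P.ω4Inv β ∧ P.ω4 (P.ω4Inv β) = β :=
  ⟨Function.invFunOn_mem hβ, Function.invFunOn_eq hβ⟩

/-- `ω₄(x) g'(x)` bounds the tilt increments over intervals from `[a, x₀]` to `[x₀, ∞)`. -/
lemma tilt_sub_le_ω4 (h : P.ThreePhase) {x p r : ℝ} (hx : P.x0 ≤ x) (hp : p ∈ Icc P.a P.x0)
    (hr : P.x0 ≤ r) : P.tilt (P.g' x) r - P.tilt (P.g' x) p ≤ P.ω4 x * P.g' x := by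
  have h1 := h.tilt_le_right hx hr
  rcases lt_or_ge x P.x3 with hc | hc
  · rw [h.ω4_of_lt hc, div_mul_cancel₀ _ (h.g'_pos x).ne']
    have := h.tilt_gInvPlus_le (h.level_mem_of_le_x3 ⟨hx, hc.le⟩) hp
    linarith
  · rw [ω4_of_ge hc, h.ω3_eq, div_mul_cancel₀ _ (h.g'_pos x).ne']
    have := h.tilt_zero_le hc hp
    linarith

/-! ### Reduction to three families of intervals -/

/-- The intervals that can be optimal. -/
def IsCandidate (P : Params) (z : ℝ × ℝ) : Prop :=
  (z.1 = 0 ∧ z.2 ∈ Icc 0 P.a ∪ Ici P.x0) ∨ (z.1 ∈ Icc P.a P.x0 ∧ P.x0 ≤ z.2)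

/-- Every interval with a positive tilt increment is a candidate or is beaten by one. -/
lemma exists_candidate (h : P.ThreePhase) {v x y : ℝ} (hx : 0 ≤ x) (hxy : x ≤ y)
    (hpos : 0 < P.tilt v y - P.tilt v x) :
    IsCandidate P (x, y) ∨ ∃ x' y', IsCandidate P (x', y') ∧
      P.tilt v y - P.tilt v x < P.tilt v y' - P.tilt v x' := by
  have hne : x ≠ y := by rintro rfl; simp at hpos
  have hlt : x < y := lt_of_le_of_ne hxy hne
  have ha0 : P.a ∈ Icc 0 P.a := right_mem_Icc.2 h.a_pos.le
  have haa : P.a ∈ Icc P.a P.x0 := left_mem_Icc.2 h.a_lt_x0.le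
  have hxx : P.x0 ∈ Icc P.a P.x0 := right_mem_Icc.2 h.a_lt_x0.le
  rcases le_or_gt x P.x0 with hx0 | hx0
  swap
  · have h1 := h.min_lt_tilt (v := v) (h.mono_right.mono Icc_subset_Ici_self) hx0 hlt
    rcases min_lt_iff.1 h1 with h1 | h1
    · exact Or.inr ⟨P.x0, y, Or.inr ⟨hxx, hx0.le.trans hxy⟩, by linarith⟩
    · linarith
  rcases le_or_gt P.a x with hax | hax
  · rcases le_or_gt P.x0 y with hy | hy
    · exact Or.inl (Or.inr ⟨⟨hax, hx0⟩, hy⟩)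
    · have h1 := h.tilt_lt_max (v := v) (h.anti_mid.mono (Icc_subset_Icc_left hax)) hlt hy
      rcases lt_max_iff.1 h1 with h1 | h1
      · linarith
      · exact Or.inr ⟨x, P.x0, Or.inr ⟨⟨hax, hx0⟩, le_rfl⟩, by linarith⟩
  rcases le_or_gt y P.a with hya | hya
  · rcases eq_or_lt_of_le hx with rfl | hx
    · exact Or.inl (Or.inl ⟨rfl, Or.inl ⟨hxy, hya⟩⟩)
    · have h1 := h.min_lt_tilt (v := v) (h.mono_left.mono (Icc_subset_Icc_right hya)) hx hlt
      rcases min_lt_iff.1 h1 with h1 | h1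
      · exact Or.inr ⟨0, y, Or.inl ⟨rfl, Or.inl ⟨(hx.trans hlt).le, hya⟩⟩, by linarith⟩
      · linarith
  -- A start inside (0, a) is no better than one of 0 and a, by quasiconcavity on [0, a].
  have hleft : x = 0 ∨ P.tilt v 0 < P.tilt v x ∨ P.tilt v P.a < P.tilt v x := by
    rcases eq_or_lt_of_le hx with h0 | hx
    · exact Or.inl h0.symm
    · exact Or.inr (min_lt_iff.1 (h.min_lt_tilt (v := v) h.mono_left hx hax))
  rcases le_or_gt P.x0 y with hy | hy
  · rcases hleft with h0 | h1 | h1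
    · exact Or.inl (Or.inl ⟨h0, Or.inr hy⟩)
    · exact Or.inr ⟨0, y, Or.inl ⟨rfl, Or.inr hy⟩, by linarith⟩
    · exact Or.inr ⟨P.a, y, Or.inr ⟨haa, hy⟩, by linarith⟩
  · right
    -- An end inside (a, x₀) is worse than one of a and x₀, by quasiconvexity. A start replaced by a
    -- cannot pair with an end replaced by a, since the increment is positive.
    rcases lt_max_iff.1 (h.tilt_lt_max (v := v) h.anti_mid hya hy) with h2 | h2
    · rcases hleft with h0 | h1 | h1
      · exact ⟨0, P.a, Or.inl ⟨rfl, Or.inl ha0⟩, by rw [h0]; linarith⟩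
      · exact ⟨0, P.a, Or.inl ⟨rfl, Or.inl ha0⟩, by linarith⟩
      · linarith
    · rcases hleft with h0 | h1 | h1
      · exact ⟨0, P.x0, Or.inl ⟨rfl, Or.inr self_mem_Ici⟩, by rw [h0]; linarith⟩
      · exact ⟨0, P.x0, Or.inl ⟨rfl, Or.inr self_mem_Ici⟩, by linarith⟩
      · exact ⟨P.a, P.x0, Or.inr ⟨haa, le_rfl⟩, by linarith⟩

/-- The maximizers of `ζ`, given a level at which the best tilt increment is `β v`: they are
candidates satisfying the first-order conditions. -/
lemma mem_Mζ_iff (h : P.ThreePhase) {β v : ℝ} (hβ : 0 < β) (hv : 0 < v)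
    (hA : ∀ y ∈ Icc 0 P.a ∪ Ici P.x0, P.tilt v y - P.tilt v 0 ≤ β * v)
    (hB : ∀ p ∈ Icc P.a P.x0, ∀ r, P.x0 ≤ r → P.tilt v r - P.tilt v p ≤ β * v)
    (hex : ∃ x y, 0 ≤ x ∧ x ≤ y ∧ P.tilt v y - P.tilt v x = β * v) (x y : ℝ) :
    (x, y) ∈ P.Mζ β ↔ P.tilt v y - P.tilt v x = β * v ∧
      ((x = 0 ∧ y ∈ P.ω3Inv β ∧ P.g' y = v) ∨
        (x ∈ Icc P.a P.x0 ∧ P.x0 ≤ y ∧ P.g' x = v ∧ P.g' y = v)) := by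
  have hβv := mul_pos hβ hv
  have hcand : ∀ x y, IsCandidate P (x, y) → P.tilt v y - P.tilt v x ≤ β * v := by
    rintro x y (⟨h1, h2⟩ | ⟨h1, h2⟩)
    · simp only at h1 h2; rw [h1]; exact hA y h2
    · exact hB x h1 y h2
  have hle : ∀ x y, 0 ≤ x → x ≤ y → P.tilt v y - P.tilt v x ≤ β * v := by
    intro x y hx hxy
    rcases le_or_gt (P.tilt v y - P.tilt v x) 0 with hn | hp
    · exact hn.trans hβv.le
    · rcases h.exists_candidate hx hxy hp with hc | ⟨x', y', hc, hlt⟩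
      · exact hcand x y hc
      · exact hlt.le.trans (hcand x' y' hc)
  rw [h.Mζ_eq hβ hv hle hex]
  constructor
  · rintro ⟨hx, hxy, he⟩
    simp only at hx hxy he
    refine ⟨he, ?_⟩
    have hlt : x < y := lt_of_le_of_ne hxy (by rintro rfl; rw [sub_self] at he; exact hβv.ne he)
    have hgy : P.g' y = v :=
      h.g'_right_eq hlt fun y' hy' => by linarith [hle x y' hx hy']
    rcases h.exists_candidate hx hxy (hβv.trans_eq he.symm) with hc | ⟨x', y', hc, hlt'⟩
    · rcases hc with ⟨h1, h2⟩ | ⟨h1, h2⟩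
      · simp only at h1 h2
        subst h1
        refine Or.inl ⟨rfl, ⟨h.mem_ω3Dom h2 fun y' hy' => ?_, ?_⟩, hgy⟩
        · rw [hgy]; linarith [hA y' hy']
        · rw [h.ω3_eq_iff, hgy]; exact he
      · refine Or.inr ⟨h1, h2, ?_, hgy⟩
        exact h.g'_left_eq (h.a_pos.trans_le h1.1) hlt fun x' h0 hx' => by
          linarith [hle x' y h0 hx']
    · exact absurd (hcand x' y' hc) (not_le.2 (he.symm.trans_lt hlt'))
  · rintro ⟨he, ⟨h1, h2, -⟩ | ⟨h1, h2, -⟩⟩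
    · subst h1
      exact ⟨le_rfl, (h.pos_of_mem_ω3Inv hβ h2).le, he⟩
    · exact ⟨h.a_pos.le.trans h1.1, h1.2.trans h2, he⟩

/-! ### The maximizers, by comparison of the two levels -/

lemma mem_wHat_iff (β x y : ℝ) : (x, y) ∈ P.wHat β ↔ x = 0 ∧ y ∈ P.ω3Inv β := by
  simp only [wHat, mem_image, Prod.mk.injEq]
  constructor
  · rintro ⟨y', h1, rfl, rfl⟩; exact ⟨rfl, h1⟩
  · rintro ⟨rfl, h1⟩; exact ⟨y, h1, rfl, rfl⟩

/-- A point of `ω₃⁻¹(β)` provides the best tilt increment from `0`, which is `β v`. -/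
lemma tilt_sub_zero_le (h : P.ThreePhase) {β u y : ℝ} (hβ : 0 < β) (hu : u ∈ P.ω3Inv β)
    (hy : y ∈ Icc 0 P.a ∪ Ici P.x0) :
    P.tilt (P.g' u) y - P.tilt (P.g' u) 0 ≤ β * P.g' u := by
  rw [← (h.ω3_eq_iff u β).1 hu.2]
  exact sub_le_sub_right (h.tilt_le_of_mem_ω3Inv hβ hu hy) _

lemma tilt_sub_zero_lt (h : P.ThreePhase) {β u v y : ℝ} (hβ : 0 < β) (hu : u ∈ P.ω3Inv β)
    (hv : 0 < v) (hvu : v < P.g' u) (hy : y ∈ Icc 0 P.a ∪ Ici P.x0) :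
    P.tilt v y - P.tilt v 0 < β * v :=
  h.tilt_sub_lt_of_lt hβ hv hvu (hy.elim (fun h1 => h1.1) fun h1 => h.x0_pos.le.trans h1)
    (h.tilt_sub_zero_le hβ hu hy)

/-- If the level of `ω₃⁻¹(β)` makes intervals starting in `[a, x₀]` strictly worse, then the
maximizers are the intervals `[0, ω₃⁻¹(β)]`. -/
lemma Mζ_eq_wHat (h : P.ThreePhase) {β u : ℝ} (hβ : 0 < β) (hu : u ∈ P.ω3Inv β)
    (hB : ∀ p ∈ Icc P.a P.x0, ∀ r, P.x0 ≤ r →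
      P.tilt (P.g' u) r - P.tilt (P.g' u) p < β * P.g' u) :
    P.Mζ β = P.wHat β := by
  ext ⟨x, y⟩
  rw [h.mem_Mζ_iff hβ (h.g'_pos u) (fun y hy => h.tilt_sub_zero_le hβ hu hy)
    (fun p hp r hr => (hB p hp r hr).le)
    ⟨0, u, le_rfl, (h.pos_of_mem_ω3Inv hβ hu).le, (h.ω3_eq_iff u β).1 hu.2⟩, mem_wHat_iff]
  constructor
  · rintro ⟨he, ⟨h1, h2, -⟩ | ⟨h1, h2, -⟩⟩
    · exact ⟨h1, h2⟩
    · exact absurd he (hB x h1 y h2).ne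
  · rintro ⟨rfl, h2⟩
    have hg := h.g'_eq_of_mem_ω3Inv hβ h2 hu
    refine ⟨?_, Or.inl ⟨rfl, h2, hg⟩⟩
    rw [← hg]; exact (h.ω3_eq_iff y β).1 h2.2

/-- On `B₃`, the level of `ω₃⁻¹(β)` does not exceed the level of `ω₄⁻¹(β)`. -/
lemma level_le_of_mem_B3 (h : P.ThreePhase) {β u : ℝ} (hβ : 0 < β) (hu : u ∈ P.ω3Inv β)
    (hx : P.x0 ≤ P.ω4Inv β) (he : P.ω3 (P.ω4Inv β) = β) :
    P.g' u ≤ P.g' (P.ω4Inv β) := by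
  by_contra hcon
  have h1 := h.tilt_sub_zero_lt hβ hu (h.g'_pos _) (not_le.1 hcon) (Or.inr hx)
  exact h1.ne ((h.ω3_eq_iff _ β).1 he)

lemma mem_image_of_mem_B3 (h : P.ThreePhase) {β : ℝ} (hβ : β ∈ P.B3) :
    β ∈ P.ω4 '' Ici P.x0 ∧ P.x3 < P.ω4Inv β := by
  have h3 := h.strictMonoOn_ω4.monotoneOn self_mem_Ici h.x0_le_x3 h.x0_le_x3
  have himg := h.bijOn_ω4.surjOn (h3.trans (le_of_lt hβ))
  obtain ⟨h1, h2⟩ := ω4Inv_spec himg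
  refine ⟨himg, (h.strictMonoOn_ω4.lt_iff_lt h.x0_le_x3 h1).1 ?_⟩
  rw [h2]; exact hβ

lemma ω4Inv_le_x3 (h : P.ThreePhase) {β : ℝ} (hβ : β ∈ P.ω4 '' Ici P.x0) (h3 : β ∉ P.B3) :
    P.ω4Inv β ≤ P.x3 := by
  obtain ⟨h1, h2⟩ := ω4Inv_spec hβ
  refine (h.strictMonoOn_ω4.le_iff_le h1 h.x0_le_x3).1 ?_
  rw [h2]; exact not_lt.1 h3

/-- Beyond x₃, ω₄ coincides with ω₃ and 0 is a strictly better start than any p in [a, x₀]. This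
supplies the strictness when the two levels agree; otherwise the level of ω₃⁻¹(β) is the smaller
one. -/
lemma Mζ_of_mem_B3 (h : P.ThreePhase) {β : ℝ} (hβ : 0 < β) (h3 : β ∈ P.B3) :
    P.Mζ β = P.wHat β := by
  obtain ⟨u, hu⟩ := h.ω3Inv_nonempty hβ
  obtain ⟨himg, hlt⟩ := h.mem_image_of_mem_B3 h3
  obtain ⟨hx, he⟩ := ω4Inv_spec himg
  have hlev := h.level_le_of_mem_B3 hβ hu hx (by rw [← ω4_of_ge hlt.le, he])
  refine h.Mζ_eq_wHat hβ hu fun p hp r hr => ?_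
  rcases eq_or_lt_of_le hlev with heq | hlev
  · have h1 := h.tilt_sub_zero_le hβ hu (Or.inr hr)
    have h2 := h.tilt_zero_lt hlt hp
    rw [← heq] at h2
    linarith
  · refine h.tilt_sub_lt_of_lt hβ (h.g'_pos u) hlev (hp.2.trans hr) ?_
    have := h.tilt_sub_le_ω4 hx hp hr
    rwa [he] at this

lemma Mζ_of_mem_B1 (h : P.ThreePhase) {β : ℝ} (hβ : β ∈ P.B1) : P.Mζ β = P.wHat β := by
  obtain ⟨hβ, u, hu, hc⟩ := hβ
  refine h.Mζ_eq_wHat hβ hu fun p hp r hr => ?_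
  by_cases himg : β ∈ P.ω4 '' Ici P.x0
  · obtain ⟨hx, he⟩ := ω4Inv_spec himg
    refine h.tilt_sub_lt_of_lt hβ (h.g'_pos u) (hc.resolve_left (not_not.2 himg))
      (hp.2.trans hr) ?_
    have := h.tilt_sub_le_ω4 hx hp hr
    rwa [he] at this
  -- If β is below the range of ω₄, then ω₄(x₀) > 0. This is impossible when x₃ > x₀, since the
  -- interval defining ω₄(x₀) is then the single point x₀. So x₃ = x₀, and ω₃(x₀) > β puts the level
  -- of u below g'(x₀).
  · have hlt : β < P.ω4 P.x0 := not_le.1 fun hn => himg (h.bijOn_ω4.surjOn hn)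
    have h3 : P.x3 ≤ P.x0 := by
      by_contra hcon
      have hx0 : P.x0 ∈ Icc P.x0 P.x3 := left_mem_Icc.2 h.x0_le_x3
      obtain ⟨hm, hge⟩ := h.gInvPlus_spec (h.level_mem_of_le_x3 hx0)
      have : P.gInvPlus (P.g' P.x0) = P.x0 :=
        h.anti_mid.injOn hm (right_mem_Icc.2 h.a_lt_x0.le) hge
      rw [h.ω4_of_lt (not_le.1 hcon), this, sub_self, zero_div] at hlt
      exact hβ.not_gt hlt
    rw [ω4_of_ge h3] at hlt
    have hlev : P.g' u < P.g' P.x0 := by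
      by_contra hcon
      have h1 := h.tilt_sub_zero_le hβ hu (Or.inr self_mem_Ici)
      rw [← div_le_iff₀ (h.g'_pos u)] at h1
      rw [h.ω3_eq] at hlt
      rcases eq_or_lt_of_le (not_lt.1 hcon) with heq | hc'
      · rw [heq] at hlt; linarith
      · have := h.tilt_div_lt (h.g'_pos _) hc' h.x0_pos
        linarith
    -- At the level g'(x₀), x₀ minimizes the tilt on [a, x₀] and maximizes it on [x₀, ∞), so the
    -- second family has only nonpositive increments.
    refine h.tilt_sub_lt_of_lt hβ (h.g'_pos u) hlev (hp.2.trans hr) ?_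
    have h1 := h.tilt_le_right le_rfl hr
    have h2 : P.tilt (P.g' P.x0) P.x0 ≤ P.tilt (P.g' P.x0) p := by
      rcases eq_or_lt_of_le hp.2 with he | hc'
      · rw [he]
      · exact (h.tilt_lt_of_lt_g' hc' fun s hs => h.anti_mid ⟨hp.1.trans hs.1.le, hs.2.le⟩
          (right_mem_Icc.2 h.a_lt_x0.le) hs.2).le
    have := mul_pos hβ (h.g'_pos P.x0)
    linarith

/-- The interval `w̃` realizes `β` at its level, when the first formula for `ω₄` applies. -/
lemma tilt_wTilde (h : P.ThreePhase) {β : ℝ} (himg : β ∈ P.ω4 '' Ici P.x0)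
    (hle : P.ω4Inv β ≤ P.x3) (hlt : P.ω4Inv β < P.x3 ∨ P.x0 < P.x3) :
    P.tilt (P.g' (P.ω4Inv β)) (P.ω4Inv β) -
      P.tilt (P.g' (P.ω4Inv β)) (P.gInvPlus (P.g' (P.ω4Inv β))) = β * P.g' (P.ω4Inv β) := by
  obtain ⟨hx, he⟩ := ω4Inv_spec himg
  have h3 : P.x0 < P.x3 := hlt.elim hx.trans_lt id
  rw [← div_eq_iff (h.g'_pos _).ne', ← h.ω4_of_le h3 hle, he]

/-- The first-order conditions determine an interval from `[a, x₀]` to `[x₀, ∞)`. -/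
lemma eq_wTilde (h : P.ThreePhase) {β x y : ℝ} (himg : β ∈ P.ω4 '' Ici P.x0)
    (hx : x ∈ Icc P.a P.x0) (hy : P.x0 ≤ y) (hgx : P.g' x = P.g' (P.ω4Inv β))
    (hgy : P.g' y = P.g' (P.ω4Inv β)) : (x, y) = P.wTilde β := by
  have hy' : y = P.ω4Inv β := h.mono_right.injOn hy (ω4Inv_spec himg).1 hgy
  have hv : P.g' x ∈ Icc (P.g' P.x0) (P.g' P.a) := by
    rw [← h.a7_spec.2]; exact h.bijOn_g'_mid.mapsTo hx
  obtain ⟨h1, h2⟩ := h.gInvPlus_spec hv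
  have hx' : x = P.gInvPlus (P.g' x) := h.anti_mid.injOn hx h1 h2.symm
  rw [wTilde, ← hgx, ← hx', ← hy']

/-- The level of ω₄⁻¹(β) is the smaller one, and at it every interval starting at 0 falls strictly
short of β v. -/
lemma Mζ_of_mem_B2 (h : P.ThreePhase) {β : ℝ} (hβ : β ∈ P.B2) (h3 : β ∉ P.B3) :
    P.Mζ β = {P.wTilde β} := by
  obtain ⟨hβ, u, hu, himg, hc⟩ := hβ
  obtain ⟨hx, he⟩ := ω4Inv_spec himg
  have hle := h.ω4Inv_le_x3 himg h3
  have hA : ∀ y ∈ Icc 0 P.a ∪ Ici P.x0, _ :=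
    fun y hy => h.tilt_sub_zero_lt hβ hu (h.g'_pos (P.ω4Inv β)) hc hy
  -- At x₃ itself, ω₄ = ω₃, so the interval [0, x₃] would attain β v.
  have hlt : P.ω4Inv β < P.x3 := lt_of_le_of_ne hle fun heq => by
    rw [ω4_of_ge heq.ge, h.ω3_eq_iff] at he
    exact (hA _ (Or.inr hx)).ne he
  have hT := h.tilt_wTilde himg hle (Or.inl hlt)
  obtain ⟨hp, hpe⟩ := h.gInvPlus_spec (h.level_mem_of_le_x3 ⟨hx, hle⟩)
  ext ⟨x, y⟩
  rw [h.mem_Mζ_iff hβ (h.g'_pos (P.ω4Inv β)) (fun y hy => (hA y hy).le)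
    (fun p hp r hr => by have := h.tilt_sub_le_ω4 hx hp hr; rwa [he] at this)
    ⟨_, _, h.a_pos.le.trans hp.1, hp.2.trans hx, hT⟩, mem_singleton_iff]
  constructor
  · rintro ⟨he', ⟨rfl, h2, -⟩ | ⟨h1, h2, h3, h4⟩⟩
    · have : y ∈ Icc 0 P.a ∪ Ici P.x0 := h2.1.imp
        (fun h5 => ⟨h5.1, h5.2.trans (h.gInvMinus_spec (h.g'_le_g'_a h.x4_mem.1)).1.2⟩)
        fun h5 => h.x0_lt_x4.le.trans h5
      exact absurd he' (hA y this).ne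
    · exact h.eq_wTilde himg h1 h2 h3 h4
  · intro heq
    obtain ⟨rfl, rfl⟩ := Prod.mk.inj heq
    exact ⟨hT, Or.inr ⟨hp, hx, hpe, rfl⟩⟩

lemma Mζ_of_notMem (h : P.ThreePhase) {β : ℝ} (hβ : 0 < β) (h1 : β ∉ P.B1) (h2 : β ∉ P.B2)
    (h3 : β ∉ P.B3) :
    β ∈ P.ω4 '' Ici P.x0 ∧ P.Mζ β = P.wHat β ∪ {P.wTilde β} := by
  obtain ⟨u, hu⟩ := h.ω3Inv_nonempty hβ
  have himg : β ∈ P.ω4 '' Ici P.x0 := by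
    by_contra hcon; exact h1 ⟨hβ, u, hu, Or.inl hcon⟩
  have hlev : P.g' u = P.g' (P.ω4Inv β) :=
    le_antisymm (not_lt.1 fun hc => h2 ⟨hβ, u, hu, himg, hc⟩)
      (not_lt.1 fun hc => h1 ⟨hβ, u, hu, Or.inr hc⟩)
  refine ⟨himg, ?_⟩
  obtain ⟨hx, he⟩ := ω4Inv_spec himg
  have hle := h.ω4Inv_le_x3 himg h3
  -- If x₃ = x₀, then [0, x₀] would be optimal at the level g'(x₀), although stopping at a is better
  -- there.
  have h03 : P.x0 < P.x3 := lt_of_le_of_ne h.x0_le_x3 fun heq => by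
    have hx0 : P.ω4Inv β = P.x0 := le_antisymm (hle.trans heq.ge) hx
    rw [hx0] at he hlev
    rw [ω4_of_ge heq.ge, h.ω3_eq_iff] at he
    have := h.tilt_sub_zero_le hβ hu (Or.inl (right_mem_Icc.2 h.a_pos.le))
    rw [hlev] at this
    linarith [h.tilt_x0_lt_a]
  have hT := h.tilt_wTilde himg hle (Or.inr h03)
  obtain ⟨hp, hpe⟩ := h.gInvPlus_spec (h.level_mem_of_le_x3 ⟨hx, hle⟩)
  ext ⟨x, y⟩
  rw [h.mem_Mζ_iff hβ (h.g'_pos (P.ω4Inv β))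
    (fun y hy => by have := h.tilt_sub_zero_le hβ hu hy; rwa [hlev] at this)
    (fun p hp r hr => by have := h.tilt_sub_le_ω4 hx hp hr; rwa [he] at this)
    ⟨_, _, h.a_pos.le.trans hp.1, hp.2.trans hx, hT⟩, mem_union, mem_wHat_iff,
    mem_singleton_iff]
  constructor
  · rintro ⟨he', ⟨rfl, h2, -⟩ | ⟨h1, h2, h3, h4⟩⟩
    · exact Or.inl ⟨rfl, h2⟩
    · exact Or.inr (h.eq_wTilde himg h1 h2 h3 h4)
  · rintro (⟨rfl, hy⟩ | heq)
    · have hg := (h.g'_eq_of_mem_ω3Inv hβ hy hu).trans hlev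
      refine ⟨?_, Or.inl ⟨rfl, hy, hg⟩⟩
      rw [← hg]; exact (h.ω3_eq_iff y β).1 hy.2
    · obtain ⟨rfl, rfl⟩ := Prod.mk.inj heq
      exact ⟨hT, Or.inr ⟨hp, hx, hpe, rfl⟩⟩

lemma B2_inter_B3 (h : P.ThreePhase) : P.B2 ∩ P.B3 = ∅ := by
  refine eq_empty_iff_forall_notMem.2 ?_
  rintro β ⟨⟨hβ, u, hu, himg, hc⟩, h3⟩
  have hlt := (h.mem_image_of_mem_B3 h3).2
  obtain ⟨hx, he⟩ := ω4Inv_spec himg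
  exact hc.not_ge (h.level_le_of_mem_B3 hβ hu hx (by rw [← ω4_of_ge hlt.le, he]))

end ThreePhase

end Params

end ImpulseDividend

theorem mainTheorem4 (P : ImpulseDividend.Params)
    (ha : 0 < P.a) (hσp : 0 < P.σp) (hσm : 0 < P.σm) (hq : 0 < P.q)
    (hμp : 0 < P.μp) (hμm : P.μm ≤ 0) :
    -- Case (i): the inverse of `φ₀` is well defined, and `M_ζ` is a singleton
    (P.CaseI →
      Set.BijOn P.φ0 (Set.Ici 0) (Set.Ici 0) ∧
      ∀ β : ℝ, 0 < β → P.Mζ β = {(0, P.φ0Inv β)}) ∧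
    (P.CaseII →
      -- well-definedness of the inverse functions
      Set.BijOn P.g' (Set.Icc P.a P.x0) (Set.Icc (P.g' P.x0) (P.g' P.a7)) ∧
      Set.BijOn P.ω4 (Set.Ici P.x0) (Set.Ici (P.ω4 P.x0)) ∧
      (∀ β : ℝ, 0 < β → β ≠ P.ω3 P.x4 → ∃ u, P.ω3Inv β = {u}) ∧
      (∀ β : ℝ, 0 < β → β = P.ω3 P.x4 →
        P.ω3Inv β = {P.gInvMinus (P.g' P.x4), P.x4} ∧
        P.g' (P.gInvMinus (P.g' P.x4)) = P.g' P.x4) ∧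
      -- the description of `M_ζ`
      (∀ β : ℝ, 0 < β →
        (β ∈ P.B1 ∪ P.B3 → P.Mζ β = P.wHat β) ∧
        (β ∈ P.B2 ∩ (Set.Ioi 0 \ P.B3) →
          β ∈ P.ω4 '' Set.Ici P.x0 ∧ P.Mζ β = {P.wTilde β}) ∧
        (β ∈ Set.Ioi 0 \ (P.B1 ∪ P.B2 ∪ P.B3) →
          β ∈ P.ω4 '' Set.Ici P.x0 ∧ P.Mζ β = P.wHat β ∪ {P.wTilde β})) ∧
      P.B2 ∩ P.B3 = ∅) := by
  have h : P.Admissible := ⟨ha, hσp, hσm, hq, hμp, hμm⟩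
  refine ⟨fun hc => ?_, fun hc => ?_⟩
  · have hm := h.strictMonoOn_g'_of_caseI hc
    exact ⟨h.regular.bijOn_φ0 hm, fun β hβ => h.regular.Mζ_eq_of_strictMonoOn hm hβ⟩
  · have h3 := h.threePhase hc
    refine ⟨h3.bijOn_g'_mid, h3.bijOn_ω4, fun β hβ hne => h3.ω3Inv_singleton hβ hne,
      fun β hβ heq => ?_, fun β hβ => ⟨?_, ?_, ?_⟩, h3.B2_inter_B3⟩
    · subst heq; exact h3.ω3Inv_of_eq hβ
    · rintro (hB | hB)
      · exact h3.Mζ_of_mem_B1 hB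
      · exact h3.Mζ_of_mem_B3 hβ hB
    · rintro ⟨hB, -, hB3⟩
      obtain ⟨-, u, -, himg, -⟩ := id hB
      exact ⟨himg, h3.Mζ_of_mem_B2 hB hB3⟩
    · rintro ⟨-, hB⟩
      exact h3.Mζ_of_notMem hβ (fun hn => hB (Or.inl (Or.inl hn)))
        (fun hn => hB (Or.inl (Or.inr hn))) fun hn => hB (Or.inr hn)
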